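/- For $n\ge 1$ let $s$ be a pseudo root joined to all vertices of a graph $G$ on $\{0,\dots,n-1\}$, and let a DFS tree of $G$ mean a DFS tree of $G+s$ rooted at $s$, i.e. a spanning tree of $G+s$ rooted at $s$ such that the endpoints of every edge of $G+s$ are in ancestor–descendant relation. The stick of a rooted tree is the downward path from the root without branching: it consists of the vertices $x$ such that $x$ and all ancestors of $x$ have exactly one child. The random graph $G(n,m)$, $0\le m\le\binom n2$, arrives as a stream formed by the first $m$ edges of a uniformly random permutation of the $\binom n2$ possible edges. A single-pass streaming algorithm keeps in its memory between two edges a tree (one parent pointer for each vertex; initially every vertex is a child of $s$) and a list of stored edges (initially empty). When an edge arrives, the new memory is computed from $n$, the old memory and this edge by one computable procedure for all $n$; the edges stored afterwards are among those stored before and the new edge. Its space, counted in words of $O(\log n)$ bits, is $n$ plus twice the number of stored edges. **Theorem.** There is a single-pass streaming algorithm such that 1. for every sequence of distinct edges on $n$ vertices, the maintained tree is, after the last edge (hence after every edge), a DFS tree of the graph formed by the edges read so far; 2. every arriving edge that has at least one endpoint on the stick of the maintained tree is discarded, i.e. it is not stored; 3. there is a constant $C>0$ such that for all $n\ge 2$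 and all $m\le\binom n2$, the expectation, for $G(n,m)$, of the largest space used at any time during the stream is at most $C\,n\log n$. In particular the expected largest number of stored edges is $O(n\log n)$. -/

import Mathlib

namespace SemiStream

/-! ### Rooted trees, DFS trees, the stick

A rooted tree on `V` is given by its parent map `par`, with `par root = root`. -/

/-- `u` is an ancestor of `v` (every vertex is an ancestor of itself). -/
def IsAncestor {V : Type*} (par : V → V) (u v : V) : Prop :=
  ∃ k : ℕ, par^[k] v = u

/-- `par` is the parent map of a DFS tree of the undirected graph `H` rooted at `root`: a rooted
spanning tree of `H` without cross edges, i.e. the endpoints of every edge of `H` are in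
ancestor-descendant relation. -/
structure IsDFSTree {V : Type*} (H : SimpleGraph V) (root : V) (par : V → V) : Prop where
  par_root : par root = root
  adj_par : ∀ v, v ≠ root → H.Adj v (par v)
  root_ancestor : ∀ v, IsAncestor par root v
  no_cross : ∀ u v, H.Adj u v → IsAncestor par u v ∨ IsAncestor par v u

/-- `c` is a child of `u`. -/
def IsChild {V : Type*} (root : V) (par : V → V) (c u : V) : Prop :=
  c ≠ root ∧ par c = u

/-- `x` lies on the stick: the downward path from the root on which there is no branching, i.e.
every vertex on the way from the root to `x`, both included, has exactly one child. The vertices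
that are not on the stick form the bristles. -/
def OnStick {V : Type*} (root : V) (par : V → V) (x : V) : Prop :=
  ∀ u, IsAncestor par u x → ∃! c, IsChild root par c u

/-! ### Edges, streams, and the graph with the pseudo root -/

/-- The possible edges of a graph on `Fin n`. -/
abbrev Edge (n : ℕ) : Type := {e : Fin n × Fin n // e.1 < e.2}

/-- The graph on `Fin n` with edge list `L`, augmented with the pseudo root `Fin.last n`, which is
adjacent to all vertices; the vertex `v : Fin n` is `v.castSucc`. -/
def augGraph {n : ℕ} (L : List (Edge n)) : SimpleGraph (Fin (n + 1)) :=
  SimpleGraph.fromRel fun u v =>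
    u = Fin.last n ∨ ∃ e ∈ L, u = e.1.1.castSucc ∧ v = e.1.2.castSucc

/-! ### Single-pass streaming algorithms -/

/-- The memory: one parent pointer for each vertex (the maintained tree), and the stored edges. -/
@[ext] structure Memory (n : ℕ) where
  parent : Fin n → Fin (n + 1)
  stored : List (Edge n)

namespace Memory

/-- Before the stream starts, every vertex is a child of the pseudo root and no edge is stored. -/
def init (n : ℕ) : Memory n where
  parent := fun _ => Fin.last n
  stored := []

/-- The parent map of the maintained tree, which is rooted at the pseudo root. -/
def par {n : ℕ} (M : Memory n) : Fin (n + 1) → Fin (n + 1) :=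
  Fin.lastCases (Fin.last n) M.parent

/-- The edge `e` has at least one endpoint on the stick of the maintained tree. -/
def TouchesStick {n : ℕ} (M : Memory n) (e : Edge n) : Prop :=
  OnStick (Fin.last n) M.par e.1.1.castSucc ∨ OnStick (Fin.last n) M.par e.1.2.castSucc

/-- The space in words, each word holding one vertex (`O(log n)` bits): one word for each parent
pointer and two words for each stored edge. -/
def space {n : ℕ} (M : Memory n) : ℕ :=
  n + 2 * M.stored.length

end Memory

/-- An edge as a pair of numbers. -/
def encodeEdge {n : ℕ} (e : Edge n) : ℕ × ℕ :=
  (e.1.1.val, e.1.2.val)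

/-- The content of the memory as lists of numbers. -/
def encodeMemory {n : ℕ} (M : Memory n) : List ℕ × List (ℕ × ℕ) :=
  (List.ofFn fun v => (M.parent v).val, M.stored.map encodeEdge)

/-- A single-pass streaming algorithm: it reads the edges one by one, and its new memory is computed
from `n`, its present memory and the edge just read, by a procedure that is uniform in `n`.
The edges stored afterwards are among those stored before and the edge just read. -/
structure Algorithm where
  update : (n : ℕ) → Memory n → Edge n → Memory n
  stored_update : ∀ (n : ℕ) (M : Memory n) (e : Edge n),
    List.Sublist (update n M e).stored (M.stored ++ [e])
  computable_update :
    ∃ f : ℕ × (List ℕ × List (ℕ × ℕ)) × (ℕ × ℕ) → List ℕ × List (ℕ × ℕ),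
      Computable f ∧
        ∀ (n : ℕ) (M : Memory n) (e : Edge n),
          f (n, encodeMemory M, encodeEdge e) = encodeMemory (update n M e)

/-- The memory after the algorithm has read the stream `L`. -/
def Algorithm.run (A : Algorithm) {n : ℕ} (L : List (Edge n)) : Memory n :=
  L.foldl (A.update n) (Memory.init n)

/-- The largest space that the algorithm occupies while it reads `L`. -/
def Algorithm.peakSpace (A : Algorithm) {n : ℕ} (L : List (Edge n)) : ℕ :=
  (Finset.range (L.length + 1)).sup fun t => (A.run (L.take t)).space

/-! ### The random graph `G(n, m)` -/

/-- The orderings (permutations) of all possible edges. -/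
abbrev EdgeOrder (n : ℕ) : Type := Fin (Fintype.card (Edge n)) ≃ Edge n

/-- The first `m` edges in the ordering `σ`; for uniformly random `σ` this is `G(n, m)` under
insertion of its edges. -/
def firstEdges {n : ℕ} (σ : EdgeOrder n) (m : ℕ) : List (Edge n) :=
  (List.ofFn σ).take m

/-- The expectation of `X` for a uniformly random ordering of the edges. -/
noncomputable def expectation {n : ℕ} (X : EdgeOrder n → ℝ) : ℝ :=
  (∑ σ : EdgeOrder n, X σ) / (Fintype.card (EdgeOrder n) : ℝ)

end SemiStream

namespace SemiStream

/-! ### Rooted trees given by parent maps -/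

section Tree

variable {V : Type*} {par : V → V} {root : V}

/-! A stick vertex is comparable with every vertex, so an edge touching the stick cannot become a
cross edge while the stick survives, and it may be forgotten. The algorithm therefore never gives up
its stick. At each edge it searches exhaustively for a tree that has no cross edge among the stored
edges and the new one, keeps the old stick, and prolongs it by a greedy rule: from a stick vertex
the path continues along the earliest edge of the stream to a vertex that is not yet on the path,
and from the pseudo root it goes to vertex 0. The conditions (`IsUpdate`) mention only the memory
and the new edge, so the search is computable.

The search succeeds (`Invariant.exists_update`). A spanning tree of maximal total depth with a
prescribed trunk has no cross edges. If the lowest trunk vertex has exactly one child, the vertices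
off the trunk are connected among themselves, so the trunk can be continued to any neighbour off it,
in particular to the one that the rule demands.

For the space bound, the greedy rule makes the stick an initial part of one path determined by the
ordering alone (`Invariant.greedyPath`). Whether a list `w` is such a part depends only on the
relative order of the edges touching `w`, hence is independent of the positions of the edges
avoiding `w` (`card_mul_sum_mul`). If the tree branches after `h` edges with `r` vertices left, some
cut of these vertices was missed by the first `h` edges. A union bound over the few greedy paths and
over the smaller sides of cuts shows that `h * r > 3 n² log n` then has probability at most `4 / n`
(`card_unlucky_le`). So typically only `O((n² log n / h)²)` possible edges avoid the stick.

An edge at position `i` that is ever stored must avoid the stick that was present after `i / 2`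
edges. Given that prefix, the edge is uniform among at least half of all edges, so the event has
probability `O(n² log² n / i² + 1 / n)`. Summing over `i` from about `2 n log n` on, and counting
all earlier edges as stored, gives `O(n log n)`. The count does not depend on the time of
inspection, so it bounds the peak. -/

theorem IsAncestor.refl (v : V) : IsAncestor par v v := ⟨0, rfl⟩

theorem IsAncestor.trans {u v w : V} (h₁ : IsAncestor par u v) (h₂ : IsAncestor par v w) :
    IsAncestor par u w := by
  obtain ⟨k, rfl⟩ := h₁
  obtain ⟨l, rfl⟩ := h₂
  exact ⟨k + l, Function.iterate_add_apply _ _ _ _⟩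

theorem isAncestor_par (v : V) : IsAncestor par (par v) v := ⟨1, rfl⟩

theorem IsAncestor.total {u w v : V} (h₁ : IsAncestor par u v) (h₂ : IsAncestor par w v) :
    IsAncestor par u w ∨ IsAncestor par w u := by
  obtain ⟨k, rfl⟩ := h₁
  obtain ⟨l, rfl⟩ := h₂
  rcases le_total k l with h | h
  · exact Or.inr ⟨l - k, by rw [← Function.iterate_add_apply, Nat.sub_add_cancel h]⟩
  · exact Or.inl ⟨k - l, by rw [← Function.iterate_add_apply, Nat.sub_add_cancel h]⟩

theorem isAncestor_iff {u v : V} : IsAncestor par u v ↔ u = v ∨ IsAncestor par u (par v) := by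
  constructor
  · rintro ⟨k, rfl⟩
    cases k with
    | zero => exact Or.inl rfl
    | succ k => exact Or.inr ⟨k, rfl⟩
  · rintro (rfl | h)
    · exact IsAncestor.refl _
    · exact h.trans (isAncestor_par _)

/-- If `u` is an ancestor of `v`, then `u` is reached from `v` in fewer than `|V|` steps. -/
theorem IsAncestor.exists_lt_card [Fintype V] {u v : V} (h : IsAncestor par u v) :
    ∃ k < Fintype.card V, par^[k] v = u := by
  classical
  let k := Nat.find h
  have hk : par^[k] v = u := Nat.find_spec h
  refine ⟨k, ?_, hk⟩
  by_contra! hle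
  obtain ⟨i, j, hij, heq⟩ := Fintype.exists_ne_map_eq_of_card_lt
    (fun i : Fin (Fintype.card V + 1) => par^[i.val] v) (by simp)
  wlog hlt : i < j generalizing i j
  · exact this j i hij.symm heq.symm (lt_of_le_of_ne (not_lt.mp hlt) hij.symm)
  have hj : (j : ℕ) ≤ k := by omega
  have hlt' : (i : ℕ) < j := hlt
  -- Two equal iterates before step `k` enclose a loop; cutting it out reaches `u` sooner than the
  -- minimal `k`.
  refine Nat.find_min h (m := k - j + i) (by change k - j + i < k; omega) ?_
  rw [Function.iterate_add_apply]
  rw [heq, ← Function.iterate_add_apply, Nat.sub_add_cancel hj, hk]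

/-- `par` is the parent map of a tree rooted at `root`. -/
structure IsRooted (root : V) (par : V → V) : Prop where
  par_root : par root = root
  root_ancestor : ∀ v, IsAncestor par root v

theorem IsDFSTree.isRooted {H : SimpleGraph V} (h : IsDFSTree H root par) : IsRooted root par :=
  ⟨h.par_root, h.root_ancestor⟩

/-- The number of steps from `v` to the root. -/
noncomputable def depth (root : V) (par : V → V) (v : V) : ℕ := sInf {k | par^[k] v = root}

theorem depth_root : depth root par root = 0 :=
  Nat.sInf_eq_zero.2 (Or.inl rfl)

namespace IsRooted

variable (hT : IsRooted root par)
include hT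

theorem induction {P : V → Prop} (h0 : P root) (h1 : ∀ v, v ≠ root → P (par v) → P v) (v : V) :
    P v := by
  obtain ⟨k, hk⟩ := hT.root_ancestor v
  induction k generalizing v with
  | zero => exact (show v = root from hk) ▸ h0
  | succ k ih =>
    by_cases hv : v = root
    · exact hv ▸ h0
    · exact h1 v hv (ih _ hk)

theorem depth_eq {v : V} (hv : v ≠ root) : depth root par v = depth root par (par v) + 1 := by
  have h1 : par^[depth root par (par v)] (par v) = root := Nat.sInf_mem (hT.root_ancestor (par v))
  have h2 : par^[depth root par v] v = root := Nat.sInf_mem (hT.root_ancestor v)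
  apply le_antisymm
  · exact Nat.sInf_le (by simpa using h1)
  · cases hd : depth root par v with
    | zero => rw [hd] at h2; exact absurd h2 hv
    | succ k =>
      rw [hd] at h2
      exact Nat.succ_le_succ (Nat.sInf_le h2)

theorem depth_le {u v : V} (h : IsAncestor par u v) : u = v ∨ depth root par u < depth root par v := by
  induction v using hT.induction with
  | h0 =>
    obtain ⟨k, rfl⟩ := h
    exact Or.inl (Function.iterate_fixed hT.par_root k)
  | h1 v hv ih =>
    rcases isAncestor_iff.1 h with h | h
    · exact Or.inl h
    · have := hT.depth_eq hv
      rcases ih h with rfl | h'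
      · right; omega
      · right; omega

theorem antisymm {u v : V} (h₁ : IsAncestor par u v) (h₂ : IsAncestor par v u) : u = v := by
  rcases hT.depth_le h₁ with h | h
  · exact h
  · rcases hT.depth_le h₂ with h' | h'
    · exact h'.symm
    · omega

theorem eq_root_of_isAncestor {v : V} (h : IsAncestor par v root) : v = root :=
  hT.antisymm h (hT.root_ancestor v)

theorem par_ne {v : V} (hv : v ≠ root) : par v ≠ v := by
  intro h
  have := hT.depth_eq hv
  rw [h] at this
  omega

/-- A proper ancestor has a child on the way down. -/
theorem exists_child {u v : V} (h : IsAncestor par u v) (huv : u ≠ v) :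
    ∃ c, IsChild root par c u ∧ IsAncestor par c v := by
  induction v using hT.induction with
  | h0 => exact absurd (hT.eq_root_of_isAncestor h) huv
  | h1 v hv ih =>
    by_cases hu : u = par v
    · exact ⟨v, ⟨hv, hu.symm⟩, IsAncestor.refl v⟩
    · rcases isAncestor_iff.1 h with h | h
      · exact absurd h huv
      · obtain ⟨c, hc, hcv⟩ := ih h hu
        exact ⟨c, hc, hcv.trans (isAncestor_par v)⟩

end IsRooted

theorem OnStick.of_isAncestor {u x : V} (hx : OnStick root par x) (h : IsAncestor par u x) :
    OnStick root par u := fun w hw => hx w (hw.trans h)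

/-- A downward path from the root, written as a list from its lowest vertex up to the root, such
that every vertex except the lowest one has exactly one child. -/
def Trunk (root : V) (par : V → V) : List V → Prop
  | [] => False
  | [x] => x = root
  | c :: x :: w => (∀ y, IsChild root par y x ↔ y = c) ∧ Trunk root par (x :: w)

/-! ### Unbranched paths from the root and their relation to the stick -/

namespace Trunk

theorem of_cons {c x : V} {w : List V} (h : Trunk root par (c :: x :: w)) :
    Trunk root par (x :: w) := h.2

theorem isChild {c x : V} {w : List V} (h : Trunk root par (c :: x :: w)) :
    IsChild root par c x := (h.1 c).2 rfl

theorem mem_iff (hT : IsRooted root par) {x u : V} {w : List V} (h : Trunk root par (x :: w)) :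
    u ∈ x :: w ↔ IsAncestor par u x := by
  induction w generalizing x with
  | nil =>
    have hx : x = root := h
    subst hx
    simp only [List.mem_singleton]
    exact ⟨fun h => h ▸ IsAncestor.refl _, hT.eq_root_of_isAncestor⟩
  | cons y w ih =>
    rw [List.mem_cons, ih h.of_cons, isAncestor_iff (v := x), h.isChild.2]

/-- Going down the trunk, whatever lies properly below a vertex lies below its only child. -/
theorem comparable (hT : IsRooted root par) {x : V} {w : List V} (h : Trunk root par (x :: w))
    (v : V) : IsAncestor par x v ∨ IsAncestor par v x := by
  induction w generalizing x with
  | nil =>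
    have hx : x = root := h
    subst hx
    exact Or.inl (hT.root_ancestor v)
  | cons y w ih =>
    rcases ih h.of_cons with h' | h'
    · by_cases hy : y = v
      · subst hy
        exact Or.inr (h.isChild.2 ▸ isAncestor_par x)
      · obtain ⟨c, hc, hcv⟩ := hT.exists_child h' hy
        rw [(h.1 c).1 hc] at hcv
        exact Or.inl hcv
    · exact Or.inr (h'.trans (h.isChild.2 ▸ isAncestor_par x))

theorem isAncestor_of_notMem (hT : IsRooted root par) {x v : V} {w : List V}
    (h : Trunk root par (x :: w)) (hv : v ∉ w) : IsAncestor par x v := by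
  rcases h.comparable hT v with h' | h'
  · exact h'
  · rcases List.mem_cons.1 ((h.mem_iff hT).2 h') with rfl | h''
    · exact IsAncestor.refl _
    · exact absurd h'' hv

theorem existsUnique_child {x u : V} {w : List V} (h : Trunk root par (x :: w)) (hu : u ∈ w) :
    ∃! c, IsChild root par c u := by
  induction w generalizing x with
  | nil => simp at hu
  | cons y w ih =>
    rcases List.mem_cons.1 hu with rfl | hu
    · exact ⟨x, h.isChild, fun c hc => (h.1 c).1 hc⟩
    · exact ih h.of_cons hu

/-- Children of the vertices of a trunk above its lowest vertex are on the trunk. -/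
theorem child_mem {x u c : V} {w : List V} (h : Trunk root par (x :: w)) (hu : u ∈ w)
    (hc : IsChild root par c u) : c ∈ x :: w := by
  induction w generalizing x with
  | nil => simp at hu
  | cons y w ih =>
    rcases List.mem_cons.1 hu with rfl | hu
    · rw [(h.1 c).1 hc]; exact List.mem_cons_self
    · exact List.mem_cons_of_mem _ (ih h.of_cons hu)

theorem isAncestor_mem (hT : IsRooted root par) {x u v : V} {w : List V}
    (h : Trunk root par (x :: w)) (hu : u ∈ w) (hv : IsAncestor par v u) : v ∈ w := by
  induction w generalizing x with
  | nil => simp at hu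
  | cons y w ih =>
    rw [h.of_cons.mem_iff hT] at hu ⊢
    exact hv.trans hu

theorem onStick (hT : IsRooted root par) {x u : V} {w : List V} (h : Trunk root par (x :: w))
    (hu : u ∈ w) : OnStick root par u := fun _ hv =>
  h.existsUnique_child (h.isAncestor_mem hT hu hv)

/-- Everything outside `w` has `b` as an ancestor, and `b` violates the one-child condition. So the
stick is `w` without `b`: the top of the bristles does not count. -/
theorem onStick_iff (hT : IsRooted root par) {b u : V} {w : List V} (h : Trunk root par (b :: w))
    (hb : ¬ ∃! c, IsChild root par c b) : OnStick root par u ↔ u ∈ w := by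
  refine ⟨fun hu => ?_, h.onStick hT⟩
  by_contra hw
  exact hb (hu b (h.isAncestor_of_notMem hT hw))

theorem notMem (hT : IsRooted root par) {x : V} {w : List V} (h : Trunk root par (x :: w)) :
    x ∉ w := by
  cases w with
  | nil => simp
  | cons y w =>
    rw [h.of_cons.mem_iff hT, ← h.isChild.2]
    exact fun h' => hT.par_ne h.isChild.1 (hT.antisymm (isAncestor_par x) h')

theorem nodup (hT : IsRooted root par) {x : V} {w : List V} (h : Trunk root par (x :: w)) :
    (x :: w).Nodup := by
  induction w generalizing x with
  | nil => simp
  | cons y w ih => exact List.nodup_cons.2 ⟨h.notMem hT, ih h.of_cons⟩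

theorem exists_extend {x : V} {w : List V} (h : Trunk root par (x :: w))
    (hx : ∃! c, IsChild root par c x) : ∃ c, Trunk root par (c :: x :: w) := by
  obtain ⟨c, hc, huniq⟩ := hx
  exact ⟨c, fun y => ⟨huniq y, fun hy => hy ▸ hc⟩, h⟩

theorem root_mem {x : V} {w : List V} (h : Trunk root par (x :: w)) : root ∈ x :: w := by
  induction w generalizing x with
  | nil => exact (show x = root from h) ▸ List.mem_cons_self
  | cons y w ih => exact List.mem_cons_of_mem _ (ih h.of_cons)

/-- Every tree has a trunk that contains the stick and ends at the top of the bristles. -/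
theorem exists_maximal [Finite V] (hT : IsRooted root par) :
    ∃ b w, Trunk root par (b :: w) ∧ ¬ ∃! c, IsChild root par c b := by
  classical
  have := Fintype.ofFinite V
  by_contra! hcon
  -- If every trunk could be extended, there would be trunks of any length, although their vertices
  -- are distinct.
  have key : ∀ k : ℕ, ∃ b w, Trunk root par (b :: w) ∧ w.length = k := by
    intro k
    induction k with
    | zero => exact ⟨root, [], rfl, rfl⟩
    | succ k ih =>
      obtain ⟨b, w, hb, hw⟩ := ih
      obtain ⟨c, hc⟩ := hb.exists_extend (hcon b w hb)
      exact ⟨c, b :: w, hc, by simp [hw]⟩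
  obtain ⟨b, w, hb, hw⟩ := key (Fintype.card V)
  have := (hb.nodup hT).length_le_card
  simp at this
  omega

end Trunk

/-- A vertex on the stick is an ancestor or a descendant of every vertex. -/
theorem OnStick.comparable [Finite V] (hT : IsRooted root par) {x : V}
    (hx : OnStick root par x) (v : V) : IsAncestor par x v ∨ IsAncestor par v x := by
  obtain ⟨b, w, hw, hb⟩ := Trunk.exists_maximal hT
  have hxw := (hw.onStick_iff hT hb).1 hx
  by_cases hv : v ∈ w
  · exact (IsAncestor.total ((hw.mem_iff hT).1 (List.mem_cons_of_mem _ hxw))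
      ((hw.mem_iff hT).1 (List.mem_cons_of_mem _ hv)))
  · exact Or.inl (((hw.mem_iff hT).1 (List.mem_cons_of_mem _ hxw)).trans
      (hw.isAncestor_of_notMem hT hv))

end Tree

end SemiStream

namespace SemiStream

/-! ### Existence of DFS trees with a prescribed trunk -/

section Existence

variable {V : Type*} {root : V}

/-- `w` arises by extending a trunk step by step in accordance with the rule `R`. -/
def Grown (R : List V → V → Prop) : List V → Prop
  | [] => True
  | [_] => True
  | c :: x :: w => R (x :: w) c ∧ Grown R (x :: w)

theorem Trunk.congr {p q : V → V} {x : V} {w : List V} (h : Trunk root p (x :: w))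
    (hpq : ∀ u ∈ w, ∀ y, IsChild root q y u ↔ IsChild root p y u) : Trunk root q (x :: w) := by
  induction w generalizing x with
  | nil => exact h
  | cons y w ih =>
    refine ⟨fun z => (hpq y List.mem_cons_self z).trans (h.1 z), ih h.of_cons fun u hu =>
      hpq u (List.mem_cons_of_mem _ hu)⟩

theorem Trunk.tail_eq_nil {p : V → V} {x : V} {w : List V} (h : Trunk root p (x :: w))
    (hx : x = root) : w = [] := by
  cases w with
  | nil => rfl
  | cons y w => exact absurd hx h.isChild.1

theorem Trunk.of_suffix {p : V → V} {x y : V} {w w' : List V} (h : Trunk root p (y :: w'))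
    (hs : (x :: w) <:+ (y :: w')) : Trunk root p (x :: w) := by
  induction w' generalizing y with
  | nil =>
    rcases List.suffix_cons_iff.1 hs with h' | h'
    · rwa [h']
    · simp at h'
  | cons z w' ih =>
    rcases List.suffix_cons_iff.1 hs with h' | h'
    · rwa [h']
    · exact ih h.of_cons h'

/-- The list alone fixes the children of its vertices above the lowest one, so two trees sharing a
trunk agree there. This yields the condition `keeps` of an update. -/
theorem Trunk.isChild_congr {p q : V → V} {x u c : V} {w : List V} (hp : Trunk root p (x :: w))
    (hq : Trunk root q (x :: w)) (hu : u ∈ w) : IsChild root p c u ↔ IsChild root q c u := by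
  induction w generalizing x with
  | nil => simp at hu
  | cons y w ih =>
    rcases List.mem_cons.1 hu with rfl | hu
    · rw [hp.1, hq.1]
    · exact ih hp.of_cons hq.of_cons hu

theorem Trunk.exists_rule {R : List V → V → Prop} {p : V → V} {x u c : V} {w : List V}
    (hp : Trunk root p (x :: w)) (hg : Grown R (x :: w)) (hu : u ∈ w)
    (hc : IsChild root p c u) : ∃ w', Trunk root p (u :: w') ∧ R (u :: w') c := by
  induction w generalizing x with
  | nil => simp at hu
  | cons y w ih =>
    rcases List.mem_cons.1 hu with rfl | hu
    · exact ⟨w, hp.of_cons, (hp.1 c).1 hc ▸ hg.1⟩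
    · exact ih hp.of_cons hg.2 hu

theorem Trunk.grown {R : List V → V → Prop} {p : V → V} {x : V} {w : List V}
    (hT : IsRooted root p) (hp : Trunk root p (x :: w))
    (hR : ∀ u c w', Trunk root p (u :: w') → OnStick root p u → IsChild root p c u →
      R (u :: w') c) : Grown R (x :: w) := by
  induction w generalizing x with
  | nil => trivial
  | cons y w ih =>
    exact ⟨hR y x w hp.of_cons (hp.onStick hT List.mem_cons_self) hp.isChild, ih hp.of_cons⟩

/-- A spanning tree of the largest total depth among those with a given trunk is a DFS tree. -/
theorem exists_isDFSTree_trunk [Finite V] {H : SimpleGraph V} {q : V → V} {x : V} {w : List V}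
    (hq : IsRooted root q) (hadj : ∀ v, v ≠ root → H.Adj v (q v)) (hw : Trunk root q (x :: w)) :
    ∃ q', IsDFSTree H root q' ∧ Trunk root q' (x :: w) := by
  classical
  have := Fintype.ofFinite V
  obtain ⟨p, ⟨hp, hpadj, hpw⟩, hmax⟩ := Set.exists_max_image
    {q : V → V | IsRooted root q ∧ (∀ v, v ≠ root → H.Adj v (q v)) ∧ Trunk root q (x :: w)}
    (fun q => ∑ v, depth root q v) (Set.toFinite _) ⟨q, hq, hadj, hw⟩
  refine ⟨p, ⟨hp.par_root, hpadj, hp.root_ancestor, ?_⟩, hpw⟩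
  intro u v huv
  wlog hd : depth root p v ≤ depth root p u generalizing u v
  · exact (this v u huv.symm (le_of_not_ge hd)).symm
  by_contra! hcross
  obtain ⟨hc1, hc2⟩ := hcross
  have hvroot : v ≠ root := fun h => hc2 (h ▸ hp.root_ancestor u)
  -- Rehanging `v`, the end of smaller or equal depth, below `u` pushes `v` strictly down and lifts
  -- no vertex, contrary to maximality.
  set r : V → V := Function.update p v u with hr
  have hrv : r v = u := Function.update_self v u p
  have hrne : ∀ y, y ≠ v → r y = p y := fun y hy => Function.update_of_ne hy u p
  -- Vertices outside the subtree of `v` keep their path to the root; `u` is one of them, so no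
  -- cycle arises.
  have hnb : ∀ y, y ≠ root → ¬ IsAncestor p v y → y ≠ v ∧ ¬ IsAncestor p v (p y) :=
    fun y _ hy => ⟨fun h => hy (h ▸ IsAncestor.refl _), fun h => hy (h.trans (isAncestor_par y))⟩
  have hreach : ∀ y, ¬ IsAncestor p v y → IsAncestor r root y := fun y => by
    induction y using hp.induction with
    | h0 => exact fun _ => IsAncestor.refl _
    | h1 y hy ih =>
      intro h
      obtain ⟨hyv, h'⟩ := hnb y hy h
      exact isAncestor_iff.2 (Or.inr (hrne y hyv ▸ ih h'))
  have hrT : IsRooted root r := by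
    refine ⟨by rw [hrne _ hvroot.symm, hp.par_root], fun y => ?_⟩
    induction y using hp.induction with
    | h0 => exact IsAncestor.refl _
    | h1 y hy ih =>
      refine isAncestor_iff.2 (Or.inr ?_)
      by_cases hyv : y = v
      · subst hyv
        rw [hrv]
        exact hreach u hc2
      · rwa [hrne y hyv]
  have hdeq : ∀ y, ¬ IsAncestor p v y → depth root r y = depth root p y := fun y => by
    induction y using hp.induction with
    | h0 => exact fun _ => by rw [depth_root, depth_root]
    | h1 y hy ih =>
      intro h
      obtain ⟨hyv, h'⟩ := hnb y hy h
      rw [hrT.depth_eq hy, hp.depth_eq hy, hrne y hyv, ih h']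
  have hdv : depth root p v < depth root r v := by
    rw [hrT.depth_eq hvroot, hrv, hdeq u hc2]
    omega
  have hdle : ∀ y, depth root p y ≤ depth root r y := fun y => by
    induction y using hp.induction with
    | h0 => rw [depth_root]; exact Nat.zero_le _
    | h1 y hy ih =>
      by_cases hyv : y = v
      · subst hyv; exact hdv.le
      · rw [hrT.depth_eq hy, hp.depth_eq hy, hrne y hyv]
        omega
  have hmem : ∀ y ∈ x :: w, ∀ z, IsAncestor p y z ∨ IsAncestor p z y := by
    intro y hy z
    by_cases hz : z ∈ x :: w
    · exact IsAncestor.total ((hpw.mem_iff hp).1 hy) ((hpw.mem_iff hp).1 hz)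
    · exact Or.inl (((hpw.mem_iff hp).1 hy).trans
        (hpw.isAncestor_of_notMem hp fun h => hz (List.mem_cons_of_mem _ h)))
  -- Only the parent of `v` changes. This could matter for the trunk only if `u` or `v` were on it,
  -- but trunk vertices are comparable with everything and `u`, `v` are incomparable.
  have hrw : Trunk root r (x :: w) := by
    refine hpw.congr fun y hy z => ?_
    by_cases hzv : z = v
    · subst hzv
      refine ⟨fun h => ?_, fun h => ?_⟩
      · have huy : u = y := hrv.symm.trans h.2
        subst huy
        exact absurd (hmem u (List.mem_cons_of_mem _ hy) z) (by tauto)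
      · exact absurd (hmem z (hpw.child_mem hy h) u) (by tauto)
    · rw [IsChild, IsChild, hrne z hzv]
  have hradj : ∀ y, y ≠ root → H.Adj y (r y) := by
    intro y hy
    by_cases hyv : y = v
    · subst hyv; rw [hrv]; exact huv.symm
    · rw [hrne y hyv]; exact hpadj y hy
  exact absurd (hmax r ⟨hrT, hradj, hrw⟩) (not_le.2
    (Finset.sum_lt_sum (fun y _ => hdle y) ⟨v, Finset.mem_univ v, hdv⟩))

/-- A trunk whose lowest vertex `b` has only one child can be extended to any neighbour of `b`
that is not on it. -/
theorem exists_isRooted_extend {H : SimpleGraph V} {q : V → V} {b c' : V} {w : List V}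
    (hq : IsRooted root q) (hadj : ∀ v, v ≠ root → H.Adj v (q v)) (hw : Trunk root q (b :: w))
    (hb : ∃! c, IsChild root q c b) (hc' : c' ∉ b :: w) (hbc : H.Adj c' b) :
    ∃ p, IsRooted root p ∧ (∀ v, v ≠ root → H.Adj v (p v)) ∧ Trunk root p (c' :: b :: w) := by
  classical
  obtain ⟨c, hc, huniq⟩ := hb
  let K : SimpleGraph V :=
    { Adj := fun u v => H.Adj u v ∧ u ∉ b :: w ∧ v ∉ b :: w
      symm := ⟨fun u v h => ⟨h.1.symm, h.2.2, h.2.1⟩⟩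
      loopless := ⟨fun u h => H.loopless.irrefl u h.1⟩ }
  -- From a vertex off the trunk, the path upwards in `q` meets the trunk only at `b`, and it enters
  -- `b` through its only child `c`. Hence the graph off the trunk is connected.
  have hKc : ∀ v, v ∉ b :: w → K.Reachable v c := fun v => by
    induction v using hq.induction with
    | h0 => exact fun h => absurd hw.root_mem h
    | h1 v hv ih =>
      intro hvw
      by_cases hqv : q v ∈ b :: w
      · rcases List.mem_cons.1 hqv with h | h
        · rw [huniq v ⟨hv, h⟩]
        · exact absurd (hw.child_mem h ⟨hv, rfl⟩) hvw
      · have hK : K.Adj v (q v) := ⟨hadj v hv, hvw, hqv⟩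
        exact hK.reachable.trans (ih hqv)
  have hK : ∀ v, v ∉ b :: w → K.Reachable c' v := fun v hv => (hKc c' hc').trans (hKc v hv).symm
  have hstep : ∀ v, ∃ u, v ∉ b :: w → v ≠ c' → K.Adj v u ∧ K.dist c' u < K.dist c' v := by
    intro v
    by_cases hv : v ∉ b :: w ∧ v ≠ c'
    · obtain ⟨P, hP⟩ := (hK v hv.1).symm.exists_walk_length_eq_dist
      cases P with
      | nil => exact absurd rfl hv.2
      | @cons _ u _ h P =>
        refine ⟨u, fun _ _ => ⟨h, ?_⟩⟩
        have := SimpleGraph.dist_le P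
        rw [SimpleGraph.Walk.length_cons] at hP
        rw [SimpleGraph.dist_comm, SimpleGraph.dist_comm (u := c') (v := v)]
        omega
    · exact ⟨v, fun h h' => absurd ⟨h, h'⟩ hv⟩
  choose f hf using hstep
  -- Keep the trunk, hang `c'` below `b`, and span the rest by a shortest-path tree from `c'` inside
  -- `K`.
  let p : V → V := fun v => if v ∈ b :: w then q v else if v = c' then b else f v
  have hp1 : ∀ v ∈ b :: w, p v = q v := fun v hv => if_pos hv
  have hp2 : p c' = b := by simp only [p]; rw [if_neg hc', if_pos trivial]
  have hp3 : ∀ v, v ∉ b :: w → v ≠ c' → p v = f v := fun v hv hv' => by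
    simp only [p]; rw [if_neg hv, if_neg hv']
  have hqw : ∀ v ∈ b :: w, q v ∈ b :: w := fun v hv => by
    rw [hw.mem_iff hq] at hv ⊢
    exact (isAncestor_par v).trans hv
  have hanc : ∀ v ∈ b :: w, IsAncestor p root v := fun v => by
    induction v using hq.induction with
    | h0 => exact fun _ => IsAncestor.refl _
    | h1 v hv ih => exact fun h => isAncestor_iff.2 (Or.inr (hp1 v h ▸ ih (hqw v h)))
  have hancc : IsAncestor p root c' :=
    isAncestor_iff.2 (Or.inr (hp2.symm ▸ hanc b List.mem_cons_self))
  have hrooted : IsRooted root p := by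
    refine ⟨by rw [hp1 _ hw.root_mem, hq.par_root], fun v => ?_⟩
    by_cases hv : v ∈ b :: w
    · exact hanc v hv
    · induction hd : K.dist c' v using Nat.strong_induction_on generalizing v with
      | _ d ih =>
        by_cases hvc : v = c'
        · exact hvc ▸ hancc
        · obtain ⟨h1, h2⟩ := hf v hv hvc
          refine isAncestor_iff.2 (Or.inr ?_)
          rw [hp3 v hv hvc]
          exact ih _ (hd ▸ h2) _ h1.2.2 rfl
  refine ⟨p, hrooted, ?_, ?_, ?_⟩
  · intro v hv
    by_cases hvw : v ∈ b :: w
    · rw [hp1 v hvw]; exact hadj v hv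
    · by_cases hvc : v = c'
      · rw [hvc, hp2]; exact hbc
      · rw [hp3 v hvw hvc]; exact (hf v hvw hvc).1.1
  · intro y
    constructor
    · rintro ⟨hy, hpy⟩
      by_contra hyc
      by_cases hyw : y ∈ b :: w
      · rw [hp1 y hyw] at hpy
        rw [hw.mem_iff hq] at hyw
        have hyb : y = b := hq.antisymm hyw (hpy ▸ isAncestor_par y)
        exact hq.par_ne hy (hpy.trans hyb.symm)
      · rw [hp3 y hyw hyc] at hpy
        exact (hf y hyw hyc).1.2.2 (hpy ▸ List.mem_cons_self)
    · rintro rfl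
      exact ⟨fun h => hc' (h ▸ hw.root_mem), hp2⟩
  · refine hw.congr fun u hu y => ?_
    constructor
    · rintro ⟨hy, hpy⟩
      by_cases hyw : y ∈ b :: w
      · exact ⟨hy, hp1 y hyw ▸ hpy⟩
      · by_cases hyc : y = c'
        · rw [hyc, hp2] at hpy
          exact absurd (hpy ▸ hu) (hw.notMem hq)
        · rw [hp3 y hyw hyc] at hpy
          exact absurd (List.mem_cons_of_mem _ (hpy ▸ hu)) (hf y hyw hyc).1.2.2
    · intro h
      exact ⟨h.1, (hp1 y (hw.child_mem hu h)).trans h.2⟩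

/-- A trunk of a DFS tree that is grown by a rule can be continued, in a suitable DFS tree, until
it branches or ends. -/
theorem exists_isDFSTree_grown [Finite V] {H : SimpleGraph V} (R : List V → V → Prop)
    (hR : ∀ x w, root ∈ x :: w → (x = root → w = []) → (∃ y, y ∉ x :: w ∧ H.Adj y x) →
      ∃ c, c ∉ x :: w ∧ H.Adj c x ∧ R (x :: w) c)
    {q : V → V} {b : V} {w : List V} (hq : IsDFSTree H root q) (hw : Trunk root q (b :: w))
    (hg : Grown R (b :: w)) :
    ∃ q' b' w', IsDFSTree H root q' ∧ Trunk root q' (b' :: w') ∧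
      (¬ ∃! c, IsChild root q' c b') ∧ Grown R (b' :: w') ∧ (b :: w) <:+ (b' :: w') := by
  classical
  have := Fintype.ofFinite V
  induction hk : Fintype.card V - w.length using Nat.strong_induction_on
    generalizing q b w with
  | _ k ih =>
  by_cases hb : ∃! c, IsChild root q c b
  · obtain ⟨c, hc, -⟩ := id hb
    have hcw : c ∉ b :: w := by
      rw [hw.mem_iff hq.isRooted]
      intro h
      have hcb := hq.isRooted.antisymm h (hc.2 ▸ isAncestor_par c)
      exact hq.isRooted.par_ne hc.1 (hc.2.trans hcb.symm)
    obtain ⟨c', hc', hadj, hrule⟩ := hR b w hw.root_mem hw.tail_eq_nil ⟨c, hcw, hc.2 ▸ hq.adj_par c hc.1⟩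
    obtain ⟨p, hp, hpadj, hpw⟩ := exists_isRooted_extend hq.isRooted hq.adj_par hw hb hc' hadj
    obtain ⟨p', hp', hpw'⟩ := exists_isDFSTree_trunk hp hpadj hpw
    -- Distinctness of the trunk vertices bounds its length by `|V|`, so the measure decreases with
    -- each added vertex.
    have hlen := (hpw'.nodup hp'.isRooted).length_le_card
    simp only [List.length_cons] at hlen
    obtain ⟨q', b', w', h1, h2, h3, h4, h5⟩ := ih (Fintype.card V - (b :: w).length)
      (by rw [List.length_cons]; omega) hp' hpw' ⟨hrule, hg⟩ rfl
    exact ⟨q', b', w', h1, h2, h3, h4, (List.suffix_cons c' (b :: w)).trans h5⟩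
  · exact ⟨q, b, w, hq, hw, hb, hg, List.suffix_rfl⟩

end Existence

end SemiStream

namespace SemiStream

/-! ### One step of the algorithm -/

section Step

variable {n : ℕ}

/-- The edge `e` joins `x` and `u`. -/
def Joins (e : Edge n) (x u : Fin (n + 1)) : Prop :=
  (x = e.1.1.castSucc ∧ u = e.1.2.castSucc) ∨ (x = e.1.2.castSucc ∧ u = e.1.1.castSucc)

theorem Joins.symm {e : Edge n} {x u : Fin (n + 1)} (h : Joins e x u) : Joins e u x := by
  rcases h with ⟨h1, h2⟩ | ⟨h1, h2⟩
  · exact Or.inr ⟨h2, h1⟩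
  · exact Or.inl ⟨h2, h1⟩

theorem Joins.ne {e : Edge n} {x u : Fin (n + 1)} (h : Joins e x u) : x ≠ u := by
  have := e.2
  rcases h with ⟨rfl, rfl⟩ | ⟨rfl, rfl⟩ <;> simp [Fin.ext_iff] <;> omega

theorem Joins.ne_last {e : Edge n} {x u : Fin (n + 1)} (h : Joins e x u) : x ≠ Fin.last n := by
  rcases h with ⟨rfl, rfl⟩ | ⟨rfl, rfl⟩ <;> exact Fin.castSucc_ne_last _

theorem Joins.right_unique {e : Edge n} {x u v : Fin (n + 1)} (h : Joins e x u)
    (h' : Joins e x v) : u = v := by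
  have := e.2
  rcases h with ⟨h1, h2⟩ | ⟨h1, h2⟩ <;> rcases h' with ⟨h3, h4⟩ | ⟨h3, h4⟩ <;>
    simp only [Fin.ext_iff, Fin.val_castSucc] at * <;> omega

theorem joins_self (e : Edge n) : Joins e e.1.1.castSucc e.1.2.castSucc := Or.inl ⟨rfl, rfl⟩

theorem Memory.TouchesStick.of_joins {M : Memory n} {e : Edge n} {x u : Fin (n + 1)}
    (h : Joins e x u) (hM : M.TouchesStick e) :
    OnStick (Fin.last n) M.par x ∨ OnStick (Fin.last n) M.par u := by
  rcases h with ⟨rfl, rfl⟩ | ⟨rfl, rfl⟩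
  · exact hM
  · exact hM.symm

theorem augGraph_adj {L : List (Edge n)} {u v : Fin (n + 1)} :
    (augGraph L).Adj u v ↔ u ≠ v ∧ (u = Fin.last n ∨ v = Fin.last n ∨ ∃ e ∈ L, Joins e u v) := by
  simp only [augGraph, SimpleGraph.fromRel_adj]
  refine and_congr_right fun _ => ?_
  constructor
  · rintro ((h | ⟨e, he, h⟩) | (h | ⟨e, he, h⟩))
    · exact Or.inl h
    · exact Or.inr (Or.inr ⟨e, he, Or.inl h⟩)
    · exact Or.inr (Or.inl h)
    · exact Or.inr (Or.inr ⟨e, he, Or.inr h.symm⟩)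
  · rintro (h | h | ⟨e, he, h | h⟩)
    · exact Or.inl (Or.inl h)
    · exact Or.inr (Or.inl h)
    · exact Or.inl (Or.inr ⟨e, he, h⟩)
    · exact Or.inr (Or.inr ⟨e, he, h.symm⟩)

theorem augGraph_mono {L L' : List (Edge n)} (h : L ⊆ L') {u v : Fin (n + 1)}
    (ha : (augGraph L).Adj u v) : (augGraph L').Adj u v := by
  rw [augGraph_adj] at ha ⊢
  exact ⟨ha.1, ha.2.imp id (Or.imp id fun ⟨e, he, h'⟩ => ⟨e, h he, h'⟩)⟩

/-- The edge `e` leads from `x` to a vertex outside `W`. -/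
def Leaves (W : Fin (n + 1) → Prop) (x : Fin (n + 1)) (e : Edge n) : Prop :=
  ∃ u, Joins e x u ∧ ¬ W u

open Classical in
/-- `c` is the endpoint of the first edge in `L` from `x` to a vertex outside `W`; the pseudo root
prefers the vertex `0`. -/
def IsFirst (L : List (Edge n)) (W : Fin (n + 1) → Prop) (x c : Fin (n + 1)) : Prop :=
  (x = Fin.last n ∧ c.val = 0) ∨ ∃ e, (L.filter (Leaves W x ·)).head? = some e ∧ Joins e x c

/-- Later edges cannot displace the first one, so a choice made by the rule stays correct for the
rest of the stream, provided that `W` is unchanged. -/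
theorem IsFirst.append {L L' : List (Edge n)} {W : Fin (n + 1) → Prop} {x c : Fin (n + 1)}
    (h : IsFirst L W x c) : IsFirst (L ++ L') W x c := by
  refine h.imp id fun ⟨e, he, hc⟩ => ⟨e, ?_, hc⟩
  rw [List.filter_append, List.head?_append, he]
  rfl

theorem exists_isFirst {L : List (Edge n)} {W : Fin (n + 1) → Prop} {x y : Fin (n + 1)}
    (hx : x ≠ Fin.last n) (hy : ¬ W y) (hW : W (Fin.last n)) (h : (augGraph L).Adj y x) :
    ∃ c, ¬ W c ∧ (augGraph L).Adj c x ∧ IsFirst L W x c := by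
  classical
  have hy' : y ≠ Fin.last n := fun h => hy (h ▸ hW)
  obtain ⟨e, he, hj⟩ : ∃ e ∈ L, Joins e y x := by
    have := (augGraph_adj.1 h).2
    tauto
  have hmem : e ∈ L.filter (Leaves W x ·) := by
    rw [List.mem_filter]
    exact ⟨he, by simpa using ⟨y, hj.symm, hy⟩⟩
  obtain ⟨e', he'⟩ : ∃ e', (L.filter (Leaves W x ·)).head? = some e' := by
    cases hl : (L.filter (Leaves W x ·)).head? with
    | none => rw [List.head?_eq_none_iff] at hl; rw [hl] at hmem; simp at hmem
    | some e' => exact ⟨e', rfl⟩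
  have hm := List.mem_of_mem_head? he'
  rw [List.mem_filter] at hm
  obtain ⟨c, hc, hcW⟩ : Leaves W x e' := by simpa using hm.2
  refine ⟨c, hcW, augGraph_adj.2 ⟨hc.symm.ne, Or.inr (Or.inr ⟨e', hm.1, hc.symm⟩)⟩,
    Or.inr ⟨e', he', hc⟩⟩

@[simp] theorem Memory.par_last (M : Memory n) : M.par (Fin.last n) = Fin.last n :=
  Fin.lastCases_last

@[simp] theorem Memory.par_castSucc (M : Memory n) (v : Fin n) :
    M.par v.castSucc = M.parent v := Fin.lastCases_castSucc _

/-- The tree of `T` can replace the one of `M` when the edge `e` arrives. -/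
structure IsUpdate (M : Memory n) (e : Edge n) (T : Memory n) : Prop where
  known : ∀ v : Fin n, T.parent v = Fin.last n ∨
    (∃ e' ∈ M.stored ++ [e], Joins e' v.castSucc (T.parent v)) ∨ T.parent v = M.parent v
  root_ancestor : ∀ v, IsAncestor T.par (Fin.last n) v
  no_cross : ∀ e' ∈ M.stored ++ [e],
    IsAncestor T.par e'.1.1.castSucc e'.1.2.castSucc ∨
      IsAncestor T.par e'.1.2.castSucc e'.1.1.castSucc
  keeps : ∀ v : Fin n, OnStick (Fin.last n) M.par (M.parent v) ∨
    OnStick (Fin.last n) M.par (T.parent v) → T.parent v = M.parent v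
  first : ∀ v : Fin n, OnStick (Fin.last n) T.par (T.parent v) →
    ¬ OnStick (Fin.last n) M.par (T.parent v) →
    IsFirst (M.stored ++ [e]) (IsAncestor T.par · (T.parent v)) (T.parent v) v.castSucc

open Classical in
/-- The state of the memory after the edges in `L`. -/
structure Invariant (L : List (Edge n)) (M : Memory n) : Prop where
  isDFSTree : IsDFSTree (augGraph L) (Fin.last n) M.par
  stored_eq : M.stored = L.filter (¬ M.TouchesStick ·)
  first : ∀ v : Fin n, OnStick (Fin.last n) M.par (M.parent v) →
    IsFirst L (IsAncestor M.par · (M.parent v)) (M.parent v) v.castSucc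

/-! ### Persistence of the stick under an update -/

section Keeps

variable {M T : Memory n}

theorem isChild_last_iff {c x : Fin (n + 1)} :
    IsChild (Fin.last n) M.par c x ↔ ∃ v : Fin n, c = v.castSucc ∧ M.parent v = x := by
  constructor
  · rintro ⟨hc, h⟩
    obtain ⟨v, rfl⟩ := Fin.exists_castSucc_eq.2 hc
    exact ⟨v, rfl, by simpa using h⟩
  · rintro ⟨v, rfl, h⟩
    exact ⟨Fin.castSucc_ne_last v, by simpa using h⟩

variable (h : ∀ v : Fin n, OnStick (Fin.last n) M.par (M.parent v) ∨
    OnStick (Fin.last n) M.par (T.parent v) → T.parent v = M.parent v)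
include h

theorem par_eq_of_onStick {x : Fin (n + 1)} (hx : OnStick (Fin.last n) M.par x) :
    T.par x = M.par x := by
  induction x using Fin.lastCases with
  | last => simp
  | cast v =>
    rw [M.par_castSucc, T.par_castSucc]
    exact h v (Or.inl (hx.of_isAncestor (M.par_castSucc v ▸ isAncestor_par _)))

theorem iterate_eq_of_onStick {x : Fin (n + 1)} (hx : OnStick (Fin.last n) M.par x) (k : ℕ) :
    T.par^[k] x = M.par^[k] x := by
  induction k generalizing x with
  | zero => rfl
  | succ k ih =>
    rw [Function.iterate_succ_apply, Function.iterate_succ_apply, par_eq_of_onStick h hx,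
      ih (hx.of_isAncestor (isAncestor_par x))]

theorem isAncestor_iff_of_onStick {x u : Fin (n + 1)} (hx : OnStick (Fin.last n) M.par x) :
    IsAncestor T.par u x ↔ IsAncestor M.par u x :=
  exists_congr fun k => by rw [iterate_eq_of_onStick h hx k]

theorem isChild_iff_of_onStick {x c : Fin (n + 1)} (hx : OnStick (Fin.last n) M.par x) :
    IsChild (Fin.last n) T.par c x ↔ IsChild (Fin.last n) M.par c x := by
  rw [isChild_last_iff, isChild_last_iff]
  refine exists_congr fun v => and_congr_right fun _ => ?_
  constructor
  · rintro rfl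
    exact (h v (Or.inr hx)).symm
  · rintro rfl
    exact h v (Or.inl hx)

/-- The stick never shrinks: its vertices keep both their ancestors and their children. -/
theorem onStick_of_onStick {x : Fin (n + 1)} (hx : OnStick (Fin.last n) M.par x) :
    OnStick (Fin.last n) T.par x := by
  intro u hu
  rw [isAncestor_iff_of_onStick h hx] at hu
  simp only [isChild_iff_of_onStick h (hx.of_isAncestor hu)]
  exact hx u hu

theorem touchesStick_of_touchesStick {e : Edge n} (he : M.TouchesStick e) : T.TouchesStick e :=
  he.imp (onStick_of_onStick h) (onStick_of_onStick h)

/-- Below the old stick the discarded edges do not matter for the next vertex of the stick. -/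
theorem isFirst_stored_iff {L : List (Edge n)} {e : Edge n} (hM : Invariant L M)
    (hT : IsRooted (Fin.last n) T.par) {x c : Fin (n + 1)}
    (hx : ¬ OnStick (Fin.last n) M.par x) :
    IsFirst (M.stored ++ [e]) (IsAncestor T.par · x) x c ↔
      IsFirst (L ++ [e]) (IsAncestor T.par · x) x c := by
  classical
  -- If an end lay on the old stick, it could not be `x`; as the other end it would be comparable
  -- with `x`, hence either an ancestor of `x` or below `x`, and the latter would put `x` on the old
  -- stick.
  have hP : ∀ e', Leaves (IsAncestor T.par · x) x e' → ¬ M.TouchesStick e' := by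
    rintro e' ⟨u, hj, hu⟩ ht
    rcases ht.of_joins hj with h' | h'
    · exact hx h'
    · rcases (onStick_of_onStick h h').comparable hT x with h'' | h''
      · exact hu h''
      · exact hx (h'.of_isAncestor ((isAncestor_iff_of_onStick h h').1 h''))
  have : (M.stored ++ [e]).filter (Leaves (IsAncestor T.par · x) x ·) =
      (L ++ [e]).filter (Leaves (IsAncestor T.par · x) x ·) := by
    rw [List.filter_append, List.filter_append, hM.stored_eq, List.filter_filter]
    congr 1
    refine List.filter_congr fun e' _ => ?_
    by_cases h' : Leaves (IsAncestor T.par · x) x e'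
    · simp [h', hP e' h']
    · simp [h']
  rw [IsFirst, IsFirst, this]

end Keeps

theorem Invariant.stored_subset {L : List (Edge n)} {M : Memory n} (h : Invariant L M) :
    M.stored ⊆ L := by
  rw [h.stored_eq]
  exact List.filter_subset_self _

theorem Invariant.mem_stored_or {L : List (Edge n)} {M : Memory n} (h : Invariant L M)
    {e : Edge n} (he : e ∈ L) : e ∈ M.stored ∨ M.TouchesStick e := by
  by_cases ht : M.TouchesStick e
  · exact Or.inr ht
  · rw [h.stored_eq, List.mem_filter]
    exact Or.inl ⟨he, by simpa using ht⟩

open Classical in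
-- The discarded edges cannot be checked, but each has an end on the old stick. That end is on the
-- new stick as well and thus comparable with everything, so no discarded edge is a cross edge.
theorem Invariant.update {L : List (Edge n)} {M T : Memory n} {e : Edge n} (hM : Invariant L M)
    (hU : IsUpdate M e T) : Invariant (L ++ [e])
      ⟨T.parent, (M.stored ++ [e]).filter (¬ T.TouchesStick ·)⟩ := by
  have hT : IsRooted (Fin.last n) T.par := ⟨T.par_last, hU.root_ancestor⟩
  constructor
  · change IsDFSTree _ _ T.par
    refine ⟨hT.par_root, fun v hv => ?_, hT.root_ancestor, fun u v huv => ?_⟩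
    · obtain ⟨v, rfl⟩ := Fin.exists_castSucc_eq.2 hv
      rw [T.par_castSucc]
      rcases hU.known v with h | ⟨e', he', h⟩ | h
      · rw [h]; exact augGraph_adj.2 ⟨hv, Or.inr (Or.inl rfl)⟩
      · refine augGraph_adj.2 ⟨h.ne, Or.inr (Or.inr ⟨e', ?_, h⟩)⟩
        rcases List.mem_append.1 he' with h' | h'
        · exact List.mem_append_left _ (hM.stored_subset h')
        · exact List.mem_append_right _ h'
      · have := hM.isDFSTree.adj_par _ hv
        rw [M.par_castSucc] at this
        rw [h]
        exact augGraph_mono (List.subset_append_left _ _) this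
    · rcases (augGraph_adj.1 huv).2 with rfl | rfl | ⟨e', he', hj⟩
      · exact Or.inl (hT.root_ancestor v)
      · exact Or.inr (hT.root_ancestor u)
      · have key : e' ∈ M.stored ++ [e] ∨ M.TouchesStick e' := by
          rcases List.mem_append.1 he' with h' | h'
          · exact (hM.mem_stored_or h').imp (List.mem_append_left _) id
          · exact Or.inl (List.mem_append_right _ h')
        rcases key with h | h
        · rcases hj with ⟨rfl, rfl⟩ | ⟨rfl, rfl⟩
          · exact hU.no_cross e' h
          · exact (hU.no_cross e' h).symm
        · rcases h.of_joins hj with h | h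
          · exact (onStick_of_onStick hU.keeps h).comparable hT v
          · exact ((onStick_of_onStick hU.keeps h).comparable hT u).symm
  · change (M.stored ++ [e]).filter (¬ T.TouchesStick ·) = (L ++ [e]).filter (¬ T.TouchesStick ·)
    rw [List.filter_append, List.filter_append, hM.stored_eq, List.filter_filter]
    congr 1
    refine List.filter_congr fun e' _ => ?_
    by_cases h' : M.TouchesStick e'
    · simp [touchesStick_of_touchesStick hU.keeps h']
    · simp [h']
  · intro v (hv : OnStick (Fin.last n) T.par (T.parent v))
    change IsFirst _ (IsAncestor T.par · (T.parent v)) (T.parent v) _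
    by_cases hs : OnStick (Fin.last n) M.par (T.parent v)
    · have heq := hU.keeps v (Or.inr hs)
      simp only [isAncestor_iff_of_onStick hU.keeps hs]
      rw [heq] at hs ⊢
      exact (hM.first v hs).append
    · exact (isFirst_stored_iff hU.keeps hM hT hs).1 (hU.first v hv hs)

/-- The tree is built in the full graph, including the discarded edges. It nevertheless uses only
known edges: a discarded edge touches the old stick, and there all parents are kept. -/
theorem Invariant.exists_update {L : List (Edge n)} {M : Memory n} (hM : Invariant L M)
    (e : Edge n) : ∃ T, IsUpdate M e T := by
  have hMT := hM.isDFSTree.isRooted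
  obtain ⟨b, w, hw, hb⟩ := Trunk.exists_maximal hMT
  obtain ⟨q₀, hq₀, hw₀⟩ := exists_isDFSTree_trunk (H := augGraph (L ++ [e])) hMT
    (fun v hv => augGraph_mono (List.subset_append_left _ _) (hM.isDFSTree.adj_par v hv)) hw
  let R : List (Fin (n + 1)) → Fin (n + 1) → Prop := fun W c =>
    ∃ x w, W = x :: w ∧ IsFirst (L ++ [e]) (· ∈ W) x c
  have hR : ∀ x w, Fin.last n ∈ x :: w → (x = Fin.last n → w = []) →
      (∃ y, y ∉ x :: w ∧ (augGraph (L ++ [e])).Adj y x) →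
      ∃ c, c ∉ x :: w ∧ (augGraph (L ++ [e])).Adj c x ∧ R (x :: w) c := by
    rintro x w hlast hxw ⟨y, hy, hyx⟩
    -- At the pseudo root no stream edge can decide; as it is adjacent to all vertices, vertex 0 is
    -- always available.
    by_cases hx : x = Fin.last n
    · subst hx
      rw [hxw rfl] at hy ⊢
      have hy' : y ≠ Fin.last n := by simpa using hy
      obtain ⟨v, rfl⟩ := Fin.exists_castSucc_eq.2 hy'
      have h0 : (⟨0, by omega⟩ : Fin (n + 1)) ≠ Fin.last n := by
        have := v.2
        simp only [ne_eq, Fin.ext_iff, Fin.val_last]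
        omega
      exact ⟨⟨0, by omega⟩, by simpa using h0, augGraph_adj.2 ⟨h0, Or.inr (Or.inl rfl)⟩,
        _, _, rfl, Or.inl ⟨rfl, rfl⟩⟩
    · obtain ⟨c, h1, h2, h3⟩ := exists_isFirst (W := (· ∈ x :: w)) hx hy hlast hyx
      exact ⟨c, h1, h2, x, w, rfl, h3⟩
  have hg : Grown R (b :: w) := hw.grown hMT fun u c w' hu hs hc => by
    refine ⟨u, w', rfl, ?_⟩
    obtain ⟨v, rfl, rfl⟩ := isChild_last_iff.1 hc
    simp only [hu.mem_iff hMT]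
    exact (hM.first v hs).append
  obtain ⟨q, b', w', hq, hw', hb', hg', hsuf⟩ := exists_isDFSTree_grown R hR hq₀ hw₀ hg
  let T : Memory n := ⟨fun v => q v.castSucc, []⟩
  have hTq : T.par = q := by
    funext v
    induction v using Fin.lastCases with
    | last => rw [T.par_last, hq.par_root]
    | cast v => rw [T.par_castSucc]
  have hstick : ∀ x, OnStick (Fin.last n) M.par x ↔ x ∈ w := fun x => hw.onStick_iff hMT hb
  have hwq := hw'.of_suffix hsuf
  have hkeep : ∀ v : Fin n, OnStick (Fin.last n) M.par (M.parent v) ∨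
      OnStick (Fin.last n) M.par (T.parent v) → T.parent v = M.parent v := by
    intro v hv
    have hne := Fin.castSucc_ne_last v
    rw [hstick, hstick] at hv
    rcases hv with hv | hv
    · have := (hw.isChild_congr hwq (c := v.castSucc) hv).1 ⟨hne, M.par_castSucc v⟩
      exact this.2
    · have := (hw.isChild_congr hwq (c := v.castSucc) hv).2 ⟨hne, rfl⟩
      rw [← this.2, M.par_castSucc]
  refine ⟨T, ?_, ?_, ?_, hkeep, ?_⟩
  · intro v
    have hadj := hq.adj_par v.castSucc (Fin.castSucc_ne_last v)
    rcases (augGraph_adj.1 hadj).2 with h | h | ⟨e', he', hj⟩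
    · exact absurd h (Fin.castSucc_ne_last v)
    · exact Or.inl h
    · rcases List.mem_append.1 he' with h' | h'
      · rcases hM.mem_stored_or h' with h'' | h''
        · exact Or.inr (Or.inl ⟨e', List.mem_append_left _ h'', hj⟩)
        · refine Or.inr (Or.inr (hkeep v ?_))
          rcases h''.of_joins hj with h | h
          · exact Or.inl (h.of_isAncestor (M.par_castSucc v ▸ isAncestor_par _))
          · exact Or.inr h
      · exact Or.inr (Or.inl ⟨e', List.mem_append_right _ h', hj⟩)
  · rw [hTq]; exact hq.root_ancestor
  · intro e' he'
    rw [hTq]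
    refine hq.no_cross _ _ (augGraph_adj.2
      ⟨(joins_self e').ne, Or.inr (Or.inr ⟨e', ?_, joins_self e'⟩)⟩)
    rcases List.mem_append.1 he' with h' | h'
    · exact List.mem_append_left _ (hM.stored_subset h')
    · exact List.mem_append_right _ h'
  · intro v hv hnv
    rw [isFirst_stored_iff hkeep hM (hTq ▸ hq.isRooted) hnv]
    rw [hTq] at hv ⊢
    have hv' := (hw'.onStick_iff hq.isRooted hb').1 hv
    obtain ⟨w'', h1, x, w₁, heq, h2⟩ := hw'.exists_rule hg' hv'
      (c := v.castSucc) ⟨Fin.castSucc_ne_last v, rfl⟩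
    obtain ⟨rfl, rfl⟩ := List.cons.inj heq
    simp only [h1.mem_iff hq.isRooted] at h2
    exact h2

theorem invariant_init (n : ℕ) : Invariant [] (Memory.init n) := by
  have hpar : ∀ v, (Memory.init n).par v = Fin.last n := fun v => by
    induction v using Fin.lastCases with
    | last => simp
    | cast v => rw [Memory.par_castSucc]; rfl
  refine ⟨⟨hpar _, fun v hv => ?_, fun v => ⟨1, hpar v⟩, fun u v huv => ?_⟩, rfl, ?_⟩
  · rw [hpar]
    exact augGraph_adj.2 ⟨hv, Or.inr (Or.inl rfl)⟩
  · rcases (augGraph_adj.1 huv).2 with rfl | rfl | ⟨e, he, -⟩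
    · exact Or.inl ⟨1, hpar v⟩
    · exact Or.inr ⟨1, hpar u⟩
    · simp at he
  · intro v hv
    refine Or.inl ⟨rfl, ?_⟩
    -- The initial tree is a star, so its root is on the stick only if there is exactly one vertex.
    have hv0 : (⟨0, v.pos⟩ : Fin n) = v := by
      obtain ⟨c, -, hc⟩ := hv _ (IsAncestor.refl _)
      have h1 := hc _ (isChild_last_iff.2 ⟨v, rfl, rfl⟩)
      have h2 := hc _ (isChild_last_iff.2 ⟨⟨0, v.pos⟩, rfl, rfl⟩)
      exact Fin.castSucc_injective n (h2.trans h1.symm)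
    rw [← hv0]
    rfl

end Step

end SemiStream

namespace SemiStream

/-! ### Computability of the step -/

section Bounded

variable {α β : Type*} [Primcodable α] [Primcodable β]

theorem primrecPred_forall_mem {f : α → List β} {P : α → β → Prop} (hf : Primrec f)
    (hP : PrimrecPred fun x : α × β => P x.1 x.2) : PrimrecPred fun a => ∀ b ∈ f a, P a b :=
  (PrimrecRel.forall_mem_list (R := fun b a => P a b)
    (hP.comp (Primrec.snd.pair Primrec.fst))).comp hf Primrec.id

theorem primrecPred_exists_mem {f : α → List β} {P : α → β → Prop} (hf : Primrec f)
    (hP : PrimrecPred fun x : α × β => P x.1 x.2) : PrimrecPred fun a => ∃ b ∈ f a, P a b :=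
  (PrimrecRel.exists_mem_list (R := fun b a => P a b)
    (hP.comp (Primrec.snd.pair Primrec.fst))).comp hf Primrec.id

theorem primrecPred_forall_lt {f : α → ℕ} {P : α → ℕ → Prop} (hf : Primrec f)
    (hP : PrimrecPred fun x : α × ℕ => P x.1 x.2) : PrimrecPred fun a => ∀ b < f a, P a b :=
  (primrecPred_forall_mem (Primrec.list_range.comp hf) hP).of_eq fun a => by simp

theorem primrecPred_exists_lt {f : α → ℕ} {P : α → ℕ → Prop} (hf : Primrec f)
    (hP : PrimrecPred fun x : α × ℕ => P x.1 x.2) : PrimrecPred fun a => ∃ b < f a, P a b :=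
  (primrecPred_exists_mem (Primrec.list_range.comp hf) hP).of_eq fun a => by simp

open Classical in
theorem primrec_filter {f : α → List β} {P : α → β → Prop} (hf : Primrec f)
    (hP : PrimrecPred fun x : α × β => P x.1 x.2) :
    Primrec fun a => (f a).filter (P a ·) :=
  (PrimrecRel.listFilter (R := fun b a => P a b)
    (hP.comp (Primrec.snd.pair Primrec.fst))).comp hf Primrec.id

end Bounded

/-! The notions above for trees coded by the list of their parent pointers. -/

/-- `u` is an ancestor of `v` in the tree on `{0, …, n}` coded by `p`. -/
def CodeAncestor (n : ℕ) (p : List ℕ) (u v : ℕ) : Prop :=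
  ∃ k < n + 1, (fun x => p.getD x n)^[k] v = u

/-- `x` has exactly one child in the tree coded by `p`. -/
def CodeUniqueChild (n : ℕ) (p : List ℕ) (x : ℕ) : Prop :=
  ∃ c < n, p.getD c n = x ∧ ∀ d < n, p.getD d n = x → d = c

/-- `x` is on the stick of the tree coded by `p`. -/
def CodeStick (n : ℕ) (p : List ℕ) (x : ℕ) : Prop :=
  ∀ k < n + 1, CodeUniqueChild n p ((fun x => p.getD x n)^[k] x)

/-- The edge `e` leads from `x` to a vertex that is not an ancestor of `x`. -/
def CodeLeaves (n : ℕ) (p : List ℕ) (x : ℕ) (e : ℕ × ℕ) : Prop :=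
  (e.1 = x ∧ ¬ CodeAncestor n p e.2 x) ∨ (e.2 = x ∧ ¬ CodeAncestor n p e.1 x)

open Classical in
/-- `c` is the endpoint of the first edge of `Q` that leads from `x` to a non-ancestor of `x`. -/
def CodeFirst (n : ℕ) (p : List ℕ) (Q : List (ℕ × ℕ)) (x c : ℕ) : Prop :=
  (x = n ∧ c = 0) ∨ ((Q.filter (CodeLeaves n p x ·)).head? = some (x, c) ∨
    (Q.filter (CodeLeaves n p x ·)).head? = some (c, x))

/-- The tree coded by `q` can replace the one coded by `p` when the known edges are in `Q`. -/
def CodeUpdate (n : ℕ) (p : List ℕ) (Q : List (ℕ × ℕ)) (q : List ℕ) : Prop :=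
  (∀ v < n, q.getD v n = n ∨ ((∃ e ∈ Q, e = (v, q.getD v n) ∨ e = (q.getD v n, v)) ∨
    q.getD v n = p.getD v n)) ∧
  (∀ v < n + 1, CodeAncestor n q n v) ∧
  (∀ e ∈ Q, CodeAncestor n q e.1 e.2 ∨ CodeAncestor n q e.2 e.1) ∧
  (∀ v < n, ¬ (CodeStick n p (p.getD v n) ∨ CodeStick n p (q.getD v n)) ∨
    q.getD v n = p.getD v n) ∧
  (∀ v < n, ¬ CodeStick n q (q.getD v n) ∨ (CodeStick n p (q.getD v n) ∨
    CodeFirst n q Q (q.getD v n) v))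

/-- All codes of parent maps. -/
def codes (n : ℕ) : ℕ → List (List ℕ) :=
  Nat.rec [[]] fun _ ls => ls.flatMap fun l => (List.range (n + 1)).map fun a => a :: l

open Classical in
/-- The code of the new tree. -/
noncomputable def codeTree (n : ℕ) (p : List ℕ) (Q : List (ℕ × ℕ)) : List ℕ :=
  ((codes n n).filter (CodeUpdate n p Q ·)).head?.getD p

open Classical in
/-- The code of the new memory. -/
noncomputable def codeStep (x : ℕ × (List ℕ × List (ℕ × ℕ)) × (ℕ × ℕ)) :
    List ℕ × List (ℕ × ℕ) :=
  (codeTree x.1 x.2.1.1 (x.2.1.2 ++ [x.2.2]),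
    (x.2.1.2 ++ [x.2.2]).filter fun e =>
      ¬ (CodeStick x.1 (codeTree x.1 x.2.1.1 (x.2.1.2 ++ [x.2.2])) e.1 ∨
        CodeStick x.1 (codeTree x.1 x.2.1.1 (x.2.1.2 ++ [x.2.2])) e.2))

/-! ### Primitive recursiveness of the coded notions -/

section Primrec

open Primrec

variable {α : Type*} [Primcodable α] {n u v x c : α → ℕ} {p q : α → List ℕ}
  {Q : α → List (ℕ × ℕ)} {e : α → ℕ × ℕ}

theorem primrec_getD (hp : Primrec p) (hv : Primrec v) (hn : Primrec n) :
    Primrec fun a => (p a).getD (v a) (n a) :=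
  (option_getD.comp (list_getElem?.comp hp hv) hn).of_eq fun a => by
    rw [List.getD_eq_getElem?_getD]

theorem primrec_iterate (hp : Primrec p) (hu : Primrec u) (hv : Primrec v) (hn : Primrec n) :
    Primrec fun a => (fun x => (p a).getD x (n a))^[u a] (v a) :=
  nat_iterate hu hv (h := fun a x => (p a).getD x (n a))
    (primrec_getD (hp.comp fst) snd (hn.comp fst)).to₂

theorem primrecPred_codeAncestor (hn : Primrec n) (hp : Primrec p) (hu : Primrec u)
    (hv : Primrec v) : PrimrecPred fun a => CodeAncestor (n a) (p a) (u a) (v a) :=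
  primrecPred_exists_lt (succ.comp hn) (Primrec.eq.comp
    (primrec_iterate (hp.comp fst) snd (hv.comp fst) (hn.comp fst)) (hu.comp fst))

theorem primrecPred_imp {P R : α → Prop} (hP : PrimrecPred P) (hR : PrimrecPred R) :
    PrimrecPred fun a => P a → R a :=
  (hP.not.or hR).of_eq fun a => by tauto

theorem primrecPred_codeUniqueChild (hn : Primrec n) (hp : Primrec p) (hx : Primrec x) :
    PrimrecPred fun a => CodeUniqueChild (n a) (p a) (x a) :=
  primrecPred_exists_lt hn (PrimrecPred.and
    (Primrec.eq.comp (primrec_getD (hp.comp fst) snd (hn.comp fst)) (hx.comp fst))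
    (primrecPred_forall_lt (hn.comp fst) (primrecPred_imp
      (Primrec.eq.comp (primrec_getD (hp.comp (fst.comp fst)) snd (hn.comp (fst.comp fst)))
        (hx.comp (fst.comp fst)))
      (Primrec.eq.comp snd (snd.comp fst)))))

theorem primrecPred_codeStick (hn : Primrec n) (hp : Primrec p) (hx : Primrec x) :
    PrimrecPred fun a => CodeStick (n a) (p a) (x a) :=
  primrecPred_forall_lt (succ.comp hn) (primrecPred_codeUniqueChild (hn.comp fst) (hp.comp fst)
    (primrec_iterate (hp.comp fst) snd (hx.comp fst) (hn.comp fst)))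

theorem primrecPred_codeLeaves (hn : Primrec n) (hp : Primrec p) (hx : Primrec x)
    (he : Primrec e) : PrimrecPred fun a => CodeLeaves (n a) (p a) (x a) (e a) :=
  PrimrecPred.or
    (PrimrecPred.and (Primrec.eq.comp (fst.comp he) hx)
      (primrecPred_codeAncestor hn hp (snd.comp he) hx).not)
    (PrimrecPred.and (Primrec.eq.comp (snd.comp he) hx)
      (primrecPred_codeAncestor hn hp (fst.comp he) hx).not)

theorem primrecPred_codeFirst (hn : Primrec n) (hp : Primrec p) (hQ : Primrec Q)
    (hx : Primrec x) (hc : Primrec c) :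
    PrimrecPred fun a => CodeFirst (n a) (p a) (Q a) (x a) (c a) := by
  have h := list_head?.comp (primrec_filter hQ (P := fun a e => CodeLeaves (n a) (p a) (x a) e)
    (primrecPred_codeLeaves (hn.comp fst) (hp.comp fst) (hx.comp fst) snd))
  exact PrimrecPred.or (PrimrecPred.and (Primrec.eq.comp hx hn) (Primrec.eq.comp hc (const 0)))
    (PrimrecPred.or (Primrec.eq.comp h (option_some.comp (hx.pair hc)))
      (Primrec.eq.comp h (option_some.comp (hc.pair hx))))

theorem primrecPred_codeUpdate (hn : Primrec n) (hp : Primrec p) (hQ : Primrec Q)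
    (hq : Primrec q) : PrimrecPred fun a => CodeUpdate (n a) (p a) (Q a) (q a) := by
  have hn' : Primrec fun x : α × ℕ => n x.1 := hn.comp fst
  have hp' : Primrec fun x : α × ℕ => p x.1 := hp.comp fst
  have hq' : Primrec fun x : α × ℕ => q x.1 := hq.comp fst
  have hv : Primrec fun x : α × ℕ => x.2 := snd
  have hpv := primrec_getD hp' hv hn'
  have hqv := primrec_getD hq' hv hn'
  refine PrimrecPred.and ?_ (PrimrecPred.and ?_ (PrimrecPred.and ?_ (PrimrecPred.and ?_ ?_)))
  · refine primrecPred_forall_lt hn (PrimrecPred.or (Primrec.eq.comp hqv hn')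
      (PrimrecPred.or (primrecPred_exists_mem (hQ.comp fst) ?_) (Primrec.eq.comp hqv hpv)))
    exact PrimrecPred.or
      (Primrec.eq.comp snd ((hv.comp fst).pair (hqv.comp fst)))
      (Primrec.eq.comp snd ((hqv.comp fst).pair (hv.comp fst)))
  · exact primrecPred_forall_lt (succ.comp hn) (primrecPred_codeAncestor hn' hq' hn' hv)
  · exact primrecPred_forall_mem hQ (PrimrecPred.or
      (primrecPred_codeAncestor (hn.comp fst) (hq.comp fst) (fst.comp snd) (snd.comp snd))
      (primrecPred_codeAncestor (hn.comp fst) (hq.comp fst) (snd.comp snd) (fst.comp snd)))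
  · exact primrecPred_forall_lt hn (PrimrecPred.or (PrimrecPred.not (PrimrecPred.or
      (primrecPred_codeStick hn' hp' hpv) (primrecPred_codeStick hn' hp' hqv)))
      (Primrec.eq.comp hqv hpv))
  · exact primrecPred_forall_lt hn (PrimrecPred.or (PrimrecPred.not
      (primrecPred_codeStick hn' hq' hqv)) (PrimrecPred.or (primrecPred_codeStick hn' hp' hqv)
        (primrecPred_codeFirst hn' hq' (hQ.comp fst) hqv hv)))

theorem primrec_codes : Primrec fun n => codes n n := by
  refine (nat_rec' (f := id) (g := fun _ => [[]])
    (h := fun n x => x.2.flatMap fun l => (List.range (n + 1)).map fun a => a :: l)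
    Primrec.id (const _) ?_).of_eq fun n => rfl
  have h : Primrec fun x : ℕ × ℕ × List (List ℕ) => x.2.2.flatMap fun l =>
      (List.range (x.1 + 1)).map fun a => a :: l :=
    list_flatMap (snd.comp snd) (list_map (list_range.comp (succ.comp (fst.comp fst)))
      (list_cons.comp snd (snd.comp fst)).to₂).to₂
  exact h.to₂

theorem primrec_codeTree (hn : Primrec n) (hp : Primrec p) (hQ : Primrec Q) :
    Primrec fun a => codeTree (n a) (p a) (Q a) :=
  option_getD.comp (list_head?.comp (primrec_filter (primrec_codes.comp hn)
    (P := fun a q => CodeUpdate (n a) (p a) (Q a) q)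
    (primrecPred_codeUpdate (hn.comp fst) (hp.comp fst) (hQ.comp fst) snd))) hp

theorem primrec_codeStep : Primrec codeStep := by
  have hn : Primrec fun x : ℕ × (List ℕ × List (ℕ × ℕ)) × (ℕ × ℕ) => x.1 := fst
  have hp : Primrec fun x : ℕ × (List ℕ × List (ℕ × ℕ)) × (ℕ × ℕ) => x.2.1.1 :=
    fst.comp (fst.comp snd)
  have hQ : Primrec fun x : ℕ × (List ℕ × List (ℕ × ℕ)) × (ℕ × ℕ) => x.2.1.2 ++ [x.2.2] :=
    list_concat.comp (snd.comp (fst.comp snd)) (snd.comp snd)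
  have ht := primrec_codeTree hn hp hQ
  refine ht.pair ((primrec_filter hQ (P := fun x e =>
    ¬ (CodeStick x.1 (codeTree x.1 x.2.1.1 (x.2.1.2 ++ [x.2.2])) e.1 ∨
      CodeStick x.1 (codeTree x.1 x.2.1.1 (x.2.1.2 ++ [x.2.2])) e.2)) ?_).of_eq fun x =>
    List.filter_congr fun _ _ => decide_eq_decide.2 Iff.rfl)
  exact PrimrecPred.not (PrimrecPred.or
    (primrecPred_codeStick (hn.comp fst) (ht.comp fst) (fst.comp snd))
    (primrecPred_codeStick (hn.comp fst) (ht.comp fst) (snd.comp snd)))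

end Primrec

theorem mem_codes_iff {n m : ℕ} {l : List ℕ} :
    l ∈ codes n m ↔ l.length = m ∧ ∀ a ∈ l, a < n + 1 := by
  induction m generalizing l with
  | zero =>
    change l ∈ [[]] ↔ _
    simp only [List.mem_singleton, List.length_eq_zero_iff]
    constructor
    · rintro rfl; simp
    · exact fun h => h.1
  | succ m ih =>
    change l ∈ (codes n m).flatMap _ ↔ _
    simp only [List.mem_flatMap, List.mem_map, List.mem_range, ih]
    constructor
    · rintro ⟨l, ⟨rfl, h⟩, a, ha, rfl⟩
      exact ⟨rfl, List.forall_mem_cons.2 ⟨ha, h⟩⟩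
    · rintro ⟨h1, h2⟩
      cases l with
      | nil => simp at h1
      | cons a l =>
        simp only [List.mem_cons, forall_eq_or_imp, List.length_cons, Nat.add_right_cancel_iff]
          at h1 h2
        exact ⟨l, ⟨h1, h2.2⟩, a, h2.1, rfl⟩

/-! ### Agreement of the coded notions with the original ones -/

section Code

variable {n : ℕ}

/-- The code of the tree in the memory. -/
def Memory.code (M : Memory n) : List ℕ := List.ofFn fun v => (M.parent v).val

/-- At the pseudo root the look-up runs past the end of the list, and the default `n` makes the root
its own parent. -/
theorem Memory.getD_code (M : Memory n) (x : Fin (n + 1)) :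
    M.code.getD x.val n = (M.par x).val := by
  induction x using Fin.lastCases with
  | last => simp [Memory.code]
  | cast v => simp [Memory.code]

theorem Memory.getD_code_castSucc (M : Memory n) (v : Fin n) :
    M.code.getD v.val n = (M.parent v).val := by
  rw [← M.par_castSucc, ← M.getD_code, Fin.val_castSucc]

theorem Memory.iterate_code (M : Memory n) (k : ℕ) (x : Fin (n + 1)) :
    (fun x => M.code.getD x n)^[k] x.val = (M.par^[k] x).val := by
  induction k generalizing x with
  | zero => rfl
  | succ k ih => rw [Function.iterate_succ_apply, Function.iterate_succ_apply, M.getD_code, ih]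

/-- Bounding the number of steps by `n + 1` loses nothing, since an ancestor is reached in fewer
steps than there are vertices. -/
theorem Memory.codeAncestor_iff (M : Memory n) (u v : Fin (n + 1)) :
    CodeAncestor n M.code u.val v.val ↔ IsAncestor M.par u v := by
  simp only [CodeAncestor, M.iterate_code, Fin.val_inj]
  constructor
  · rintro ⟨k, -, h⟩
    exact ⟨k, h⟩
  · intro h
    simpa using h.exists_lt_card

theorem Memory.codeUniqueChild_iff (M : Memory n) (x : Fin (n + 1)) :
    CodeUniqueChild n M.code x.val ↔ ∃! c, IsChild (Fin.last n) M.par c x := by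
  simp only [isChild_last_iff]
  constructor
  · rintro ⟨c, hc, h1, h2⟩
    lift c to Fin n using hc
    rw [M.getD_code_castSucc, Fin.val_inj] at h1
    refine ⟨c.castSucc, ⟨c, rfl, h1⟩, ?_⟩
    rintro _ ⟨d, rfl, hd⟩
    rw [Fin.castSucc_inj, ← Fin.val_inj]
    exact h2 d d.2 (by rw [M.getD_code_castSucc, hd])
  · rintro ⟨_, ⟨c, rfl, hc⟩, h⟩
    refine ⟨c, c.2, by rw [M.getD_code_castSucc, hc], fun d hd hdx => ?_⟩
    lift d to Fin n using hd
    rw [M.getD_code_castSucc, Fin.val_inj] at hdx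
    rw [Fin.val_inj]
    exact Fin.castSucc_injective n (h _ ⟨d, rfl, hdx⟩)

theorem Memory.codeStick_iff (M : Memory n) (x : Fin (n + 1)) :
    CodeStick n M.code x.val ↔ OnStick (Fin.last n) M.par x := by
  simp only [CodeStick, M.iterate_code, M.codeUniqueChild_iff, OnStick]
  constructor
  · intro h u hu
    obtain ⟨k, hk, rfl⟩ := hu.exists_lt_card
    exact h k (by simpa using hk)
  · exact fun h k _ => h _ ⟨k, rfl⟩

theorem encodeEdge_eq_iff {e : Edge n} {x u : Fin (n + 1)} :
    (encodeEdge e = (x.val, u.val) ∨ encodeEdge e = (u.val, x.val)) ↔ Joins e x u := by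
  simp only [encodeEdge, Joins, Prod.mk.injEq, Fin.ext_iff, Fin.val_castSucc]
  constructor <;> rintro (h | h) <;> omega

theorem Memory.codeLeaves_iff (M : Memory n) (x : Fin (n + 1)) (e : Edge n) :
    CodeLeaves n M.code x.val (encodeEdge e) ↔ Leaves (IsAncestor M.par · x) x e := by
  have h1 := M.codeAncestor_iff e.1.1.castSucc x
  have h2 := M.codeAncestor_iff e.1.2.castSucc x
  simp only [Fin.val_castSucc] at h1 h2
  simp only [CodeLeaves, encodeEdge, h1, h2, Leaves, Joins]
  constructor
  · rintro (⟨h, h'⟩ | ⟨h, h'⟩)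
    · exact ⟨_, Or.inl ⟨Fin.ext h.symm, rfl⟩, h'⟩
    · exact ⟨_, Or.inr ⟨Fin.ext h.symm, rfl⟩, h'⟩
  · rintro ⟨u, ⟨rfl, rfl⟩ | ⟨rfl, rfl⟩, h'⟩
    · exact Or.inl ⟨rfl, h'⟩
    · exact Or.inr ⟨rfl, h'⟩

theorem Memory.codeFirst_iff (M : Memory n) (Q : List (Edge n)) (x c : Fin (n + 1)) :
    CodeFirst n M.code (Q.map encodeEdge) x.val c.val ↔
      IsFirst Q (IsAncestor M.par · x) x c := by
  classical
  have hf : (Q.map encodeEdge).filter (CodeLeaves n M.code x.val ·) =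
      (Q.filter (Leaves (IsAncestor M.par · x) x ·)).map encodeEdge := by
    rw [List.filter_map]
    congr 1
    refine List.filter_congr fun e _ => ?_
    simp [M.codeLeaves_iff x e]
  rw [CodeFirst, IsFirst, hf, List.head?_map]
  refine or_congr (and_congr_left fun _ => ?_) ?_
  · rw [Fin.ext_iff, Fin.val_last]
  · simp only [Option.map_eq_some_iff, ← exists_or, ← and_or_left]
    exact exists_congr fun e => and_congr_right fun _ => encodeEdge_eq_iff

theorem Memory.codeUpdate_iff (M T : Memory n) (e : Edge n) :
    CodeUpdate n M.code ((M.stored ++ [e]).map encodeEdge) T.code ↔ IsUpdate M e T := by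
  have key : CodeUpdate n M.code ((M.stored ++ [e]).map encodeEdge) T.code ↔
      (∀ v : Fin n, T.parent v = Fin.last n ∨
        ((∃ e' ∈ M.stored ++ [e], Joins e' v.castSucc (T.parent v)) ∨
          T.parent v = M.parent v)) ∧
      (∀ v, IsAncestor T.par (Fin.last n) v) ∧
      (∀ e' ∈ M.stored ++ [e], IsAncestor T.par e'.1.1.castSucc e'.1.2.castSucc ∨
        IsAncestor T.par e'.1.2.castSucc e'.1.1.castSucc) ∧
      (∀ v : Fin n, ¬ (OnStick (Fin.last n) M.par (M.parent v) ∨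
        OnStick (Fin.last n) M.par (T.parent v)) ∨ T.parent v = M.parent v) ∧
      (∀ v : Fin n, ¬ OnStick (Fin.last n) T.par (T.parent v) ∨
        (OnStick (Fin.last n) M.par (T.parent v) ∨
        IsFirst (M.stored ++ [e]) (IsAncestor T.par · (T.parent v)) (T.parent v)
          v.castSucc)) := by
    refine and_congr ?_ (and_congr ?_ (and_congr ?_ (and_congr ?_ ?_)))
    · rw [← Fin.forall_iff (p := fun v : Fin n => T.code.getD v.val n = n ∨
        ((∃ e' ∈ (M.stored ++ [e]).map encodeEdge,
          e' = (v.val, T.code.getD v.val n) ∨ e' = (T.code.getD v.val n, v.val)) ∨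
            T.code.getD v.val n = M.code.getD v.val n))]
      refine forall_congr' fun v => ?_
      rw [T.getD_code_castSucc, M.getD_code_castSucc, Fin.val_inj, Fin.ext_iff (b := Fin.last n),
        Fin.val_last]
      refine or_congr Iff.rfl (or_congr ?_ Iff.rfl)
      simp only [List.mem_map, exists_exists_and_eq_and]
      refine exists_congr fun e' => and_congr_right fun _ => ?_
      rw [← encodeEdge_eq_iff, Fin.val_castSucc]
    · rw [← Fin.forall_iff (p := fun v : Fin (n + 1) => CodeAncestor n T.code n v.val)]
      refine forall_congr' fun v => ?_
      rw [← T.codeAncestor_iff, Fin.val_last]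
    · rw [List.forall_mem_map]
      refine forall₂_congr fun e' _ => ?_
      rw [← T.codeAncestor_iff, ← T.codeAncestor_iff]
      rfl
    · rw [← Fin.forall_iff (p := fun v : Fin n => ¬ (CodeStick n M.code (M.code.getD v.val n) ∨
        CodeStick n M.code (T.code.getD v.val n)) ∨
        T.code.getD v.val n = M.code.getD v.val n)]
      refine forall_congr' fun v => ?_
      rw [T.getD_code_castSucc, M.getD_code_castSucc, Fin.val_inj, M.codeStick_iff,
        M.codeStick_iff]
    · rw [← Fin.forall_iff (p := fun v : Fin n => ¬ CodeStick n T.code (T.code.getD v.val n) ∨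
        (CodeStick n M.code (T.code.getD v.val n) ∨
        CodeFirst n T.code ((M.stored ++ [e]).map encodeEdge) (T.code.getD v.val n) v.val))]
      refine forall_congr' fun v => ?_
      rw [T.getD_code_castSucc, M.codeStick_iff, T.codeStick_iff, ← T.codeFirst_iff,
        Fin.val_castSucc]
  rw [key]
  constructor
  · rintro ⟨h1, h2, h3, h4, h5⟩
    exact ⟨h1, h2, h3, fun v hv => (h4 v).resolve_left (not_not.2 hv),
      fun v hv hv' => ((h5 v).resolve_left (not_not.2 hv)).resolve_left hv'⟩
  · rintro ⟨h1, h2, h3, h4, h5⟩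
    refine ⟨h1, h2, h3, fun v => ?_, fun v => ?_⟩
    · have := h4 v; tauto
    · have := h5 v; tauto

theorem Memory.code_mem (M : Memory n) : M.code ∈ codes n n := by
  rw [mem_codes_iff]
  refine ⟨by simp [Memory.code], fun a ha => ?_⟩
  obtain ⟨v, rfl⟩ := (List.mem_ofFn' _ _).1 ha
  exact (M.parent v).2

theorem exists_code_eq {l : List ℕ} (hl : l ∈ codes n n) (S : List (Edge n)) :
    ∃ T : Memory n, T.code = l ∧ T.stored = S := by
  obtain ⟨h1, h2⟩ := mem_codes_iff.1 hl
  refine ⟨⟨fun v => ⟨l[v.val], h2 _ (List.getElem_mem _)⟩, S⟩, ?_, rfl⟩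
  apply List.ext_getElem
  · simp [Memory.code, h1]
  · intro i _ _
    simp [Memory.code]

theorem codeTree_mem (M : Memory n) (Q : List (ℕ × ℕ)) : codeTree n M.code Q ∈ codes n n := by
  classical
  rw [codeTree]
  cases h : ((codes n n).filter (CodeUpdate n M.code Q ·)).head? with
  | none => exact M.code_mem
  | some l => exact (List.mem_filter.1 (List.mem_of_mem_head? h)).1

theorem codeUpdate_codeTree {M : Memory n} {Q : List (ℕ × ℕ)} {l : List ℕ} (hl : l ∈ codes n n)
    (h : CodeUpdate n M.code Q l) : CodeUpdate n M.code Q (codeTree n M.code Q) := by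
  classical
  have hmem : l ∈ (codes n n).filter (CodeUpdate n M.code Q ·) := by
    rw [List.mem_filter]
    exact ⟨hl, by simpa using h⟩
  rw [codeTree]
  cases h' : ((codes n n).filter (CodeUpdate n M.code Q ·)).head? with
  | none => rw [List.head?_eq_none_iff] at h'; rw [h'] at hmem; simp at hmem
  | some l' => simpa using (List.mem_filter.1 (List.mem_of_mem_head? h')).2

open Classical in
/-- The computed step leads to a memory of the required form. -/
theorem exists_step (M : Memory n) (e : Edge n) : ∃ T : Memory n,
    codeStep (n, encodeMemory M, encodeEdge e) = encodeMemory T ∧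
      T.stored = (M.stored ++ [e]).filter (¬ T.TouchesStick ·) ∧
      ((∃ T', IsUpdate M e T') → IsUpdate M e T) := by
  set Q := (M.stored ++ [e]).map encodeEdge with hQ
  obtain ⟨T₀, hT₀, -⟩ := exists_code_eq (codeTree_mem M Q) []
  let T : Memory n := ⟨T₀.parent, (M.stored ++ [e]).filter (¬ T₀.TouchesStick ·)⟩
  have hcode : T.code = codeTree n M.code Q := hT₀
  refine ⟨T, ?_, rfl, ?_⟩
  · have hst : ∀ e' : Edge n,
        (CodeStick n T.code (encodeEdge e').1 ∨ CodeStick n T.code (encodeEdge e').2) ↔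
          T₀.TouchesStick e' := fun e' => or_congr
      (T.codeStick_iff e'.1.1.castSucc) (T.codeStick_iff e'.1.2.castSucc)
    have hQ' : M.stored.map encodeEdge ++ [encodeEdge e] = Q := by simp [hQ]
    change (codeTree n M.code (M.stored.map encodeEdge ++ [encodeEdge e]),
      (M.stored.map encodeEdge ++ [encodeEdge e]).filter fun e' =>
        ¬ (CodeStick n (codeTree n M.code (M.stored.map encodeEdge ++ [encodeEdge e])) e'.1 ∨
          CodeStick n (codeTree n M.code (M.stored.map encodeEdge ++ [encodeEdge e])) e'.2)) =
      (T.code, T.stored.map encodeEdge)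
    rw [hQ', ← hcode]
    refine Prod.ext rfl ?_
    change Q.filter _ = ((M.stored ++ [e]).filter _).map encodeEdge
    rw [hQ, List.filter_map]
    congr 1
    refine List.filter_congr fun e' _ => ?_
    have := hst e'
    simp only [Function.comp, this]
  · rintro ⟨T', hT'⟩
    rw [← M.codeUpdate_iff] at hT' ⊢
    rw [hcode]
    exact codeUpdate_codeTree T'.code_mem hT'

end Code

open Classical in
/-- The algorithm: it replaces its tree by a DFS tree of the known graph that keeps the stick and
prolongs it along the edges that arrived first, and stores the edges that avoid the stick. -/
noncomputable def dfsAlgorithm : Algorithm where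
  update _ M e := (exists_step M e).choose
  stored_update _ M e := by
    rw [(exists_step M e).choose_spec.2.1]
    exact List.filter_sublist
  computable_update := ⟨codeStep, primrec_codeStep.to_comp,
    fun _ M e => (exists_step M e).choose_spec.1⟩

/-! ### The invariant along a stream and monotonicity of the stick -/

section Run

variable {n : ℕ}

theorem Algorithm.run_append (A : Algorithm) (L : List (Edge n)) (e : Edge n) :
    A.run (L ++ [e]) = A.update n (A.run L) e := by
  simp [Algorithm.run]

theorem invariant_run (L : List (Edge n)) : Invariant L (dfsAlgorithm.run L) := by
  classical
  induction L using List.reverseRecOn with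
  | nil => exact invariant_init n
  | append_singleton L e ih =>
    obtain ⟨-, h2, h3⟩ := (exists_step (dfsAlgorithm.run L) e).choose_spec
    have hU := h3 (ih.exists_update e)
    have := ih.update hU
    rw [Algorithm.run_append]
    convert this using 1
    exact Memory.ext rfl h2

theorem onStick_run_append {L : List (Edge n)} {x : Fin (n + 1)}
    (hx : OnStick (Fin.last n) (dfsAlgorithm.run L).par x) (L' : List (Edge n)) :
    OnStick (Fin.last n) (dfsAlgorithm.run (L ++ L')).par x := by
  induction L' using List.reverseRecOn with
  | nil => simpa using hx
  | append_singleton L' e ih =>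
    rw [← List.append_assoc, Algorithm.run_append]
    have hU := (exists_step (dfsAlgorithm.run (L ++ L')) e).choose_spec.2.2
      ((invariant_run (L ++ L')).exists_update e)
    exact onStick_of_onStick hU.keeps ih

theorem touchesStick_run_append {L : List (Edge n)} {e : Edge n}
    (h : (dfsAlgorithm.run L).TouchesStick e) (L' : List (Edge n)) :
    (dfsAlgorithm.run (L ++ L')).TouchesStick e :=
  h.imp (onStick_run_append · L') (onStick_run_append · L')

theorem notMem_stored_run {L : List (Edge n)} {e : Edge n}
    (h : (dfsAlgorithm.run L).TouchesStick e) : e ∉ (dfsAlgorithm.run L).stored := by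
  classical
  rw [(invariant_run L).stored_eq, List.mem_filter]
  simp [h]

end Run

end SemiStream

namespace SemiStream

/-! ### Random orderings -/

section Orderings

variable {α : Type*} [Fintype α] [DecidableEq α]

/-- Positions after the exposed ones are exchangeable. -/
theorem sum_apply_eq_sum_apply {k : ℕ} {G : (Fin (Fintype.card α) ≃ α) → α → ℝ}
    (hG : ∀ σ τ, (∀ l, l.val < k → σ l = τ l) → G σ = G τ) {i j : Fin (Fintype.card α)}
    (hi : k ≤ i.val) (hj : k ≤ j.val) :
    ∑ σ : Fin (Fintype.card α) ≃ α, G σ (σ i) = ∑ σ : Fin (Fintype.card α) ≃ α, G σ (σ j) := by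
  -- Exchanging the positions `i` and `j` is a bijection of the orderings that leaves the first `k`
  -- elements alone.
  let Φ : (Fin (Fintype.card α) ≃ α) ≃ (Fin (Fintype.card α) ≃ α) :=
    { toFun := fun σ => (Equiv.swap i j).trans σ
      invFun := fun σ => (Equiv.swap i j).trans σ
      left_inv := fun σ => by ext; simp
      right_inv := fun σ => by ext; simp }
  rw [← Equiv.sum_comp Φ]
  refine Finset.sum_congr rfl fun σ _ => ?_
  have h : G (Φ σ) = G σ := hG _ _ fun l hl => by
    change σ (Equiv.swap i j l) = σ l
    rw [Equiv.swap_apply_of_ne_of_ne] <;> rintro rfl <;> omega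
  rw [h]
  change G σ (σ (Equiv.swap i j i)) = _
  rw [Equiv.swap_apply_left]

theorem card_filter_le_val (N k : ℕ) (hk : k ≤ N) :
    (((Finset.univ : Finset (Fin N)).filter (k ≤ ·.val)).card : ℝ) = N - k := by
  have h := Finset.card_filter_add_card_filter_not (s := (Finset.univ : Finset (Fin N)))
    (fun i => i.val < k)
  simp only [not_lt, Finset.card_univ, Fintype.card_fin] at h
  have h2 : ((Finset.univ : Finset (Fin N)).filter (fun i => i.val < k)).card = k := by
    rw [Fin.card_filter_val_lt]
    exact min_eq_right hk
  rw [h2] at h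
  have h3 : (N : ℝ) = k + ((Finset.univ : Finset (Fin N)).filter (k ≤ ·.val)).card := by
    exact_mod_cast h.symm
  linarith

/-- All positions from `k` on contribute equally, so one of them can be replaced by their sum. -/
theorem mul_sum_apply {k : ℕ} {G : (Fin (Fintype.card α) ≃ α) → α → ℝ}
    (hG : ∀ σ τ, (∀ l, l.val < k → σ l = τ l) → G σ = G τ) {i : Fin (Fintype.card α)}
    (hi : k ≤ i.val) :
    ((Fintype.card α : ℝ) - k) * ∑ σ : Fin (Fintype.card α) ≃ α, G σ (σ i) =
      ∑ σ : Fin (Fintype.card α) ≃ α,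
        ∑ j ∈ (Finset.univ : Finset (Fin (Fintype.card α))).filter (k ≤ ·.val), G σ (σ j) := by
  rw [Finset.sum_comm, ← card_filter_le_val _ _ (hi.trans i.2.le), ← nsmul_eq_mul,
    ← Finset.sum_const]
  refine Finset.sum_congr rfl fun j hj => ?_
  exact sum_apply_eq_sum_apply hG hi (Finset.mem_filter.1 hj).2

/-- The probability that the edge at position `i` belongs to a set that is determined by the
first `k ≤ i` edges. -/
theorem mul_sum_mem_le {k : ℕ} {F : (Fin (Fintype.card α) ≃ α) → Finset α}
    (hF : ∀ σ τ, (∀ l, l.val < k → σ l = τ l) → F σ = F τ) {i : Fin (Fintype.card α)}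
    (hi : k ≤ i.val) :
    ((Fintype.card α : ℝ) - k) *
        ∑ σ : Fin (Fintype.card α) ≃ α, (if σ i ∈ F σ then (1 : ℝ) else 0) ≤
      ∑ σ : Fin (Fintype.card α) ≃ α, ((F σ).card : ℝ) := by
  rw [mul_sum_apply (G := fun σ a => if a ∈ F σ then (1 : ℝ) else 0)
    (fun σ τ h => by rw [hF σ τ h]) hi]
  refine Finset.sum_le_sum fun σ _ => ?_
  rw [Finset.sum_boole]
  refine Nat.cast_le.2 ?_
  rw [← Finset.card_map σ.toEmbedding]
  refine Finset.card_le_card fun a ha => ?_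
  simp only [Finset.mem_map, Finset.mem_filter] at ha
  obtain ⟨j, ⟨-, hj⟩, rfl⟩ := ha
  exact hj

/-- The orderings in which no element of `F` comes among the first `h` ones. -/
def avoiding (F : Finset α) (h : ℕ) : Finset (Fin (Fintype.card α) ≃ α) :=
  Finset.univ.filter fun σ => ∀ l : Fin (Fintype.card α), l.val < h → σ l ∉ F

theorem mem_avoiding {F : Finset α} {h : ℕ} {σ : Fin (Fintype.card α) ≃ α} :
    σ ∈ avoiding F h ↔ ∀ l : Fin (Fintype.card α), l.val < h → σ l ∉ F := by
  simp [avoiding]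

/-- Given that `F` was missed so far, all of `F` is among the `N - h` remaining elements, so the
next one hits it with probability `|F| / (N - h) ≥ |F| / N`. -/
theorem card_avoiding_succ_le (F : Finset α) {h : ℕ} (hh : h < Fintype.card α) :
    ((avoiding F (h + 1)).card : ℝ) ≤
      (1 - (F.card : ℝ) / Fintype.card α) * (avoiding F h).card := by
  set N := Fintype.card α with hN
  let i : Fin N := ⟨h, hh⟩
  have key := mul_sum_apply (α := α) (k := h) (i := i)
    (G := fun σ a => if σ ∈ avoiding F h ∧ a ∈ F then (1 : ℝ) else 0) (fun σ τ hst => by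
      have : σ ∈ avoiding F h ↔ τ ∈ avoiding F h := by
        rw [mem_avoiding, mem_avoiding]
        exact forall₂_congr fun l hl => by rw [hst l hl]
      simp only [this]) le_rfl
  have h1 : ∀ σ : Fin N ≃ α,
      ∑ j ∈ (Finset.univ : Finset (Fin N)).filter (h ≤ ·.val),
        (if σ ∈ avoiding F h ∧ σ j ∈ F then (1 : ℝ) else 0) =
      if σ ∈ avoiding F h then (F.card : ℝ) else 0 := by
    intro σ
    by_cases hσ : σ ∈ avoiding F h
    · simp only [hσ, true_and, if_true]
      rw [Finset.sum_boole, ← Finset.card_map σ.toEmbedding]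
      congr 2
      ext a
      simp only [Finset.mem_map, Finset.mem_filter, Finset.mem_univ, true_and]
      constructor
      · rintro ⟨j, ⟨-, hj⟩, rfl⟩
        exact hj
      · intro ha
        refine ⟨σ.symm a, ⟨?_, by simpa using ha⟩, by simp⟩
        by_contra! hlt
        exact mem_avoiding.1 hσ _ hlt (by simpa using ha)
    · simp [hσ]
  rw [Finset.sum_congr rfl fun σ _ => h1 σ] at key
  rw [Finset.sum_boole, ← Finset.sum_filter, Finset.sum_const, nsmul_eq_mul] at key
  have h2 : (avoiding F h).card = (avoiding F (h + 1)).card +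
      ((Finset.univ : Finset (Fin N ≃ α)).filter fun σ => σ ∈ avoiding F h ∧ σ i ∈ F).card := by
    rw [← Finset.card_filter_add_card_filter_not (s := avoiding F h) (fun σ => σ i ∉ F)]
    congr 2
    · ext σ
      rw [Finset.mem_filter, mem_avoiding, mem_avoiding]
      constructor
      · rintro ⟨h3, h4⟩ l hl
        rcases Nat.lt_succ_iff_lt_or_eq.1 hl with h5 | h5
        · exact h3 l h5
        · have : l = i := Fin.ext h5
          rw [this]; exact h4
      · exact fun h3 => ⟨fun l hl => h3 l (by omega), h3 i (Nat.lt_succ_self h)⟩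
    · ext σ
      simp
  have h3 : (Finset.univ.filter fun σ : Fin N ≃ α => σ ∈ avoiding F h) = avoiding F h := by
    ext; simp
  rw [h3] at key
  set x : ℝ := (((Finset.univ : Finset (Fin N ≃ α)).filter
    fun σ => σ ∈ avoiding F h ∧ σ i ∈ F).card : ℝ) with hx
  have h4 : ((avoiding F h).card : ℝ) = (avoiding F (h + 1)).card + x := by
    rw [h2]; push_cast; rfl
  have hNpos : (0 : ℝ) < N := by
    have : 0 < N := by omega
    exact_mod_cast this
  have h5 : (F.card : ℝ) / N * (avoiding F h).card ≤ x := by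
    rw [div_mul_eq_mul_div, div_le_iff₀ hNpos, mul_comm (F.card : ℝ), ← key, mul_comm x]
    have : (0 : ℝ) ≤ x := Nat.cast_nonneg _
    have : (0 : ℝ) ≤ h := Nat.cast_nonneg _
    nlinarith
  linarith

theorem card_avoiding_le (F : Finset α) {h : ℕ} (hh : h ≤ Fintype.card α) :
    ((avoiding F h).card : ℝ) ≤
      Real.exp (-(h * F.card / Fintype.card α)) * Fintype.card (Fin (Fintype.card α) ≃ α) := by
  induction h with
  | zero =>
    simp only [Nat.cast_zero, zero_mul, zero_div, neg_zero, Real.exp_zero, one_mul]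
    exact Nat.cast_le.2 (Finset.card_le_univ _)
  | succ h ih =>
    refine (card_avoiding_succ_le F hh).trans ?_
    have h1 := ih (by omega)
    have h2 : 1 - (F.card : ℝ) / Fintype.card α ≤ Real.exp (-((F.card : ℝ) / Fintype.card α)) := by
      linarith [Real.add_one_le_exp (-((F.card : ℝ) / Fintype.card α))]
    calc (1 - (F.card : ℝ) / Fintype.card α) * (avoiding F h).card
        ≤ Real.exp (-((F.card : ℝ) / Fintype.card α)) * (avoiding F h).card := by gcongr
      _ ≤ Real.exp (-((F.card : ℝ) / Fintype.card α)) *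
          (Real.exp (-(h * F.card / Fintype.card α)) *
            Fintype.card (Fin (Fintype.card α) ≃ α)) := by gcongr
      _ = _ := by
        rw [← mul_assoc, ← Real.exp_add]
        congr 2
        push_cast
        ring

/-- Any two orderings can be made to agree on the relative order of the elements of `A` by
permuting the elements of `A`. -/
theorem exists_perm_relative (A : Finset α) (σ τ : Fin (Fintype.card α) ≃ α) :
    ∃ ρ : Equiv.Perm α, (∀ x ∉ A, ρ x = x) ∧ ∀ x ∈ A, ∀ y ∈ A,
      ((τ.trans ρ).symm x ≤ (τ.trans ρ).symm y ↔ σ.symm x ≤ σ.symm y) := by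
  let S := A.map σ.symm.toEmbedding
  let T := A.map τ.symm.toEmbedding
  have hS : S.card = A.card := Finset.card_map _
  have hT : T.card = A.card := Finset.card_map _
  -- The order isomorphism between the positions of `A` under `σ` and under `τ` dictates how to
  -- relabel `A`.
  let ψ : S ≃o T := (S.orderIsoOfFin hS).symm.trans (T.orderIsoOfFin hT)
  have hmemS : ∀ x, x ∈ A ↔ σ.symm x ∈ S := fun x => by simp [S]
  have hmemT : ∀ x, x ∈ A ↔ τ.symm x ∈ T := fun x => by simp [T]
  let θ : Equiv.Perm {x // x ∈ A} :=
    (σ.symm.subtypeEquiv hmemS).trans (ψ.toEquiv.trans (τ.symm.subtypeEquiv hmemT).symm)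
  have hθ : ∀ (x : α) (hx : x ∈ A),
      τ.symm (Equiv.Perm.ofSubtype θ x) = ψ ⟨σ.symm x, (hmemS x).1 hx⟩ := by
    intro x hx
    rw [Equiv.Perm.ofSubtype_apply_of_mem θ hx]
    change τ.symm (τ _) = _
    rw [Equiv.symm_apply_apply]
    rfl
  refine ⟨(Equiv.Perm.ofSubtype θ).symm, fun x hx => ?_, fun x hx y hy => ?_⟩
  · rw [Equiv.symm_apply_eq, Equiv.Perm.ofSubtype_apply_of_not_mem θ hx]
  · change τ.symm (Equiv.Perm.ofSubtype θ x) ≤ τ.symm (Equiv.Perm.ofSubtype θ y) ↔ _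
    rw [hθ x hx, hθ y hy, Subtype.coe_le_coe, ψ.le_iff_le]
    rfl

/-- The relative order of the elements of `A` is independent of the positions of the other
elements. -/
theorem card_mul_sum_mul (A : Finset α) {f g : (Fin (Fintype.card α) ≃ α) → ℝ}
    (hf : ∀ σ τ : Fin (Fintype.card α) ≃ α,
      (∀ x ∈ A, ∀ y ∈ A, (σ.symm x ≤ σ.symm y ↔ τ.symm x ≤ τ.symm y)) → f σ = f τ)
    (hg : ∀ σ τ : Fin (Fintype.card α) ≃ α, (∀ x ∉ A, σ.symm x = τ.symm x) → g σ = g τ) :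
    (Fintype.card (Fin (Fintype.card α) ≃ α) : ℝ) *
      ∑ σ : Fin (Fintype.card α) ≃ α, f σ * g σ =
      (∑ σ : Fin (Fintype.card α) ≃ α, f σ) * ∑ σ : Fin (Fintype.card α) ≃ α, g σ := by
  classical
  -- Shuffling `A` by `H` preserves the uniform distribution and does not change `g`, so `f` may be
  -- replaced by its average over `H`.
  let H : Finset (Equiv.Perm α) := Finset.univ.filter fun ρ => ∀ x ∉ A, ρ x = x
  have hH : ∀ ρ, ρ ∈ H ↔ ∀ x ∉ A, ρ x = x := fun ρ => by simp [H]
  let Φ (ρ : Equiv.Perm α) : (Fin (Fintype.card α) ≃ α) ≃ (Fin (Fintype.card α) ≃ α) :=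
    { toFun := fun σ => σ.trans ρ
      invFun := fun σ => σ.trans ρ.symm
      left_inv := fun σ => by ext; simp
      right_inv := fun σ => by ext; simp }
  have hinvA : ∀ ρ ∈ H, ∀ x ∈ A, ρ.symm x ∈ A := fun ρ hρ x hx => by
    by_contra h
    have := (hH ρ).1 hρ _ h
    rw [Equiv.apply_symm_apply] at this
    exact h (this ▸ hx)
  have hinv : ∀ ρ ∈ H, ∀ x ∉ A, ρ.symm x = x := fun ρ hρ x hx => by
    rw [Equiv.symm_apply_eq, (hH ρ).1 hρ x hx]
  have hshift : ∀ u : (Fin (Fintype.card α) ≃ α) → ℝ,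
      (∀ σ τ : Fin (Fintype.card α) ≃ α, (∀ x ∉ A, σ.symm x = τ.symm x) → u σ = u τ) →
      (H.card : ℝ) * ∑ σ, f σ * u σ = ∑ σ, u σ * ∑ ρ ∈ H, f (σ.trans ρ) := by
    intro u hu
    simp_rw [Finset.mul_sum (s := H)]
    rw [Finset.sum_comm, ← nsmul_eq_mul, ← Finset.sum_const]
    refine Finset.sum_congr rfl fun ρ hρ => ?_
    rw [← Equiv.sum_comp (Φ ρ)]
    refine Finset.sum_congr rfl fun σ _ => ?_
    have : u (Φ ρ σ) = u σ := hu _ _ fun x hx => by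
      change σ.symm (ρ.symm x) = _
      rw [hinv ρ hρ x hx]
    rw [this, mul_comm]
    rfl
  -- This average is constant: up to an element of `H`, any two orderings order `A` alike, and `f`
  -- sees nothing else.
  have hconst : ∀ σ τ : Fin (Fintype.card α) ≃ α,
      ∑ ρ ∈ H, f (σ.trans ρ) = ∑ ρ ∈ H, f (τ.trans ρ) := by
    intro σ τ
    obtain ⟨ρ₀, h1, h2⟩ := exists_perm_relative A σ τ
    have hρ₀ : ρ₀ ∈ H := (hH _).2 h1
    refine Finset.sum_bij' (fun ρ _ => ρ₀.trans ρ) (fun ρ _ => ρ₀.symm.trans ρ) ?_ ?_ ?_ ?_ ?_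
    · intro ρ hρ
      rw [hH] at hρ ⊢
      intro x hx
      rw [Equiv.trans_apply, h1 x hx, hρ x hx]
    · intro ρ hρ
      rw [hH] at hρ ⊢
      intro x hx
      rw [Equiv.trans_apply, hinv ρ₀ hρ₀ x hx, hρ x hx]
    · intro ρ _; ext; simp
    · intro ρ _; ext; simp
    · intro ρ hρ
      refine hf _ _ fun x hx y hy => ?_
      exact (h2 _ (hinvA ρ hρ x hx) _ (hinvA ρ hρ y hy)).symm
  have hHpos : (H.card : ℝ) ≠ 0 := by
    have : (1 : Equiv.Perm α) ∈ H := (hH _).2 fun _ _ => rfl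
    exact Nat.cast_ne_zero.2 (Finset.card_ne_zero_of_mem this)
  obtain ⟨σ₀⟩ : Nonempty (Fin (Fintype.card α) ≃ α) := ⟨(Fintype.equivFin α).symm⟩
  have e1 := hshift g hg
  -- The case `g = 1` identifies the constant average.
  have e2 := hshift (fun _ => 1) fun _ _ _ => rfl
  simp_rw [fun σ => hconst σ σ₀] at e1 e2
  rw [← Finset.sum_mul] at e1 e2
  simp only [mul_one, Finset.sum_const, Finset.card_univ, nsmul_eq_mul] at e2
  have : (H.card : ℝ) * ((Fintype.card (Fin (Fintype.card α) ≃ α) : ℝ) * ∑ σ, f σ * g σ) =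
      H.card * ((∑ σ, f σ) * ∑ σ, g σ) := by
    rw [mul_left_comm, e1, ← mul_assoc (H.card : ℝ), e2]
    ring
  exact mul_left_cancel₀ hHpos this

end Orderings

end SemiStream

namespace SemiStream

/-! ### The greedy path and the size of the bristles -/

section Greedy

variable {n : ℕ}

/-- `c` comes next after `x` on the greedy path that has visited `W`: the edge from `x` to `c` is
the earliest one that leads from `x` to a vertex outside `W`. -/
def NextVertex (σ : EdgeOrder n) (W : List (Fin (n + 1))) (x c : Fin (n + 1)) : Prop :=
  (x = Fin.last n ∧ c.val = 0) ∨
    ∃ e, Joins e x c ∧ c ∉ W ∧ ∀ e', Leaves (· ∈ W) x e' → σ.symm e ≤ σ.symm e'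

/-- `w` lists the vertices of an initial part of the greedy path, the last one first. -/
def GreedyPath (σ : EdgeOrder n) : List (Fin (n + 1)) → Prop
  | [] => False
  | [x] => x = Fin.last n
  | c :: x :: w => NextVertex σ (x :: w) x c ∧ GreedyPath σ (x :: w)

theorem NextVertex.unique {σ : EdgeOrder n} {W : List (Fin (n + 1))} {x c c' : Fin (n + 1)}
    (h : NextVertex σ W x c) (h' : NextVertex σ W x c') : c = c' := by
  rcases h with ⟨h1, h2⟩ | ⟨e, h1, h2, h3⟩ <;> rcases h' with ⟨h1', h2'⟩ | ⟨e', h1', h2', h3'⟩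
  · exact Fin.ext (h2.trans h2'.symm)
  · exact absurd h1 h1'.ne_last
  · exact absurd h1' h1.ne_last
  · have := le_antisymm (h3 e' ⟨c', h1', h2'⟩) (h3' e ⟨c, h1, h2⟩)
    rw [σ.symm.injective this] at h1
    exact h1.right_unique h1'

/-- The rule is deterministic, so an ordering has at most one greedy path of each length. This keeps
the later union bound small. -/
theorem GreedyPath.unique {σ : EdgeOrder n} {w w' : List (Fin (n + 1))} (h : GreedyPath σ w)
    (h' : GreedyPath σ w') (hl : w.length = w'.length) : w = w' := by
  induction w generalizing w' with
  | nil => exact absurd h id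
  | cons c w ih =>
    cases w' with
    | nil => exact absurd h' id
    | cons c' w' =>
      simp only [List.length_cons, Nat.add_right_cancel_iff] at hl
      cases w with
      | nil =>
        obtain rfl := List.length_eq_zero_iff.1 hl.symm
        rw [show c = _ from h, show c' = _ from h']
      | cons x w =>
        cases w' with
        | nil => simp at hl
        | cons x' w' =>
          have := ih h.2 h'.2 hl
          rw [this] at h ⊢
          obtain ⟨rfl, -⟩ := List.cons.inj this
          rw [h.1.unique h'.1]

/-- The greedy path depends only on the relative order of the edges that touch it. -/
theorem GreedyPath.congr {σ τ : EdgeOrder n} {w : List (Fin (n + 1))} {A : Finset (Edge n)}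
    (hA : ∀ e x u, x ∈ w → Joins e x u → e ∈ A)
    (hστ : ∀ e ∈ A, ∀ e' ∈ A, (σ.symm e ≤ σ.symm e' ↔ τ.symm e ≤ τ.symm e'))
    (h : GreedyPath σ w) : GreedyPath τ w := by
  induction w with
  | nil => exact h
  | cons c w ih =>
    cases w with
    | nil => exact h
    | cons x w =>
      refine ⟨h.1.imp id ?_, ih (fun e y u hy => hA e y u (List.mem_cons_of_mem _ hy)) h.2⟩
      rintro ⟨e, h1, h2, h3⟩
      refine ⟨e, h1, h2, fun e' he' => ?_⟩
      have hx : x ∈ c :: x :: w := List.mem_cons_of_mem _ List.mem_cons_self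
      rw [← hστ e (hA e x c hx h1) e' (by obtain ⟨u, hu, -⟩ := he'; exact hA e' x u hx hu)]
      exact h3 e' he'

/-- Edges beyond the prefix come later, so the first suitable edge of the prefix is the first one of
the whole ordering. -/
theorem IsFirst.nextVertex {σ : EdgeOrder n} {h : ℕ} {W : List (Fin (n + 1))}
    {x c : Fin (n + 1)} (hf : IsFirst (firstEdges σ h) (· ∈ W) x c) (hc : c ∉ W) :
    NextVertex σ W x c := by
  classical
  refine hf.imp id ?_
  rintro ⟨e, he, hj⟩
  refine ⟨e, hj, hc, fun e' he' => ?_⟩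
  rw [List.head?_filter, List.find?_eq_some_iff_getElem] at he
  obtain ⟨-, i, hi, hie, hlt⟩ := he
  simp only [firstEdges, List.getElem_take, List.getElem_ofFn] at hie hlt
  rw [← hie, Equiv.symm_apply_apply]
  by_contra! hlt'
  have := hlt (σ.symm e').val hlt'
  simp [he'] at this

theorem Invariant.greedyPath {σ : EdgeOrder n} {h : ℕ} {M : Memory n}
    (hM : Invariant (firstEdges σ h) M) {b : Fin (n + 1)} {w : List (Fin (n + 1))}
    (hw : Trunk (Fin.last n) M.par (b :: w)) : GreedyPath σ (b :: w) := by
  have hT := hM.isDFSTree.isRooted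
  induction w generalizing b with
  | nil => exact hw
  | cons x w ih =>
    refine ⟨?_, ih hw.of_cons⟩
    have hs := hw.onStick hT (u := x) List.mem_cons_self
    obtain ⟨v, rfl, rfl⟩ := isChild_last_iff.1 hw.isChild
    have := hM.first v hs
    simp only [← hw.of_cons.mem_iff hT] at this
    exact this.nextVertex (hw.notMem hT)

/-- The vertices of the graph that are not in `w`. -/
def rest (w : List (Fin (n + 1))) : Finset (Fin n) :=
  Finset.univ.filter fun v => v.castSucc ∉ w

theorem mem_rest {w : List (Fin (n + 1))} {v : Fin n} : v ∈ rest w ↔ v.castSucc ∉ w := by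
  simp [rest]

/-- The possible edges between `X` and `R \ X`. -/
def crossing (X R : Finset (Fin n)) : Finset (Edge n) :=
  Finset.univ.filter fun e =>
    (e.1.1 ∈ X ∧ e.1.2 ∈ R \ X) ∨ (e.1.2 ∈ X ∧ e.1.1 ∈ R \ X)

theorem mem_crossing {X R : Finset (Fin n)} {e : Edge n} : e ∈ crossing X R ↔
    (e.1.1 ∈ X ∧ e.1.2 ∈ R \ X) ∨ (e.1.2 ∈ X ∧ e.1.1 ∈ R \ X) := by
  simp [crossing]

theorem crossing_sdiff {X R : Finset (Fin n)} (hX : X ⊆ R) :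
    crossing (R \ X) R = crossing X R := by
  ext e
  rw [mem_crossing, mem_crossing, Finset.sdiff_sdiff_eq_self hX]
  tauto

theorem card_mul_card_le_card_crossing (X R : Finset (Fin n)) :
    X.card * (R \ X).card ≤ (crossing X R).card := by
  rw [← Finset.card_product]
  refine Finset.card_le_card_of_surjOn
    (fun e => if e.1.1 ∈ X then e.1 else e.1.swap) ?_
  rintro ⟨x, y⟩ hxy
  simp only [Finset.coe_product, Set.mem_prod, Finset.mem_coe] at hxy
  have hy : y ∉ X := (Finset.mem_sdiff.1 hxy.2).2
  rcases lt_trichotomy x y with h | rfl | h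
  · refine ⟨⟨(x, y), h⟩, ?_, by simp [hxy.1]⟩
    rw [Finset.mem_coe, mem_crossing]
    exact Or.inl hxy
  · exact absurd hxy.1 hy
  · refine ⟨⟨(y, x), h⟩, ?_, by simp [hy]⟩
    rw [Finset.mem_coe, mem_crossing]
    exact Or.inr hxy

theorem two_mul_card_edge (n : ℕ) : 2 * Fintype.card (Edge n) + n = n * n := by
  have h1 : Fintype.card (Edge n) =
      ((Finset.univ : Finset (Fin n × Fin n)).filter fun p => p.1 < p.2).card :=
    Fintype.card_subtype _
  have h2 : ((Finset.univ : Finset (Fin n × Fin n)).filter fun p => p.2 < p.1).card =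
      ((Finset.univ : Finset (Fin n × Fin n)).filter fun p => p.1 < p.2).card :=
    Finset.card_bij (fun p _ => p.swap) (by simp) (by simp) (fun p hp => ⟨p.swap, by simpa using hp⟩)
  have h3 : ((Finset.univ : Finset (Fin n × Fin n)).filter fun p => p.1 = p.2).card = n := by
    have : ((Finset.univ : Finset (Fin n × Fin n)).filter fun p => p.1 = p.2) =
        (Finset.univ : Finset (Fin n)).image fun i => (i, i) := by
      ext ⟨i, j⟩; simp
    rw [this, Finset.card_image_of_injective _ fun i j h => (Prod.ext_iff.1 h).1]
    simp
  have h4 := Finset.card_filter_add_card_filter_not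
    (s := (Finset.univ : Finset (Fin n × Fin n))) (fun p => p.1 < p.2)
  have h5 := Finset.card_filter_add_card_filter_not
    (s := (Finset.univ : Finset (Fin n × Fin n)).filter fun p => ¬ p.1 < p.2) (fun p => p.1 = p.2)
  rw [Finset.filter_filter, Finset.filter_filter] at h5
  have h6 : ((Finset.univ : Finset (Fin n × Fin n)).filter fun p => ¬ p.1 < p.2 ∧ p.1 = p.2) =
      (Finset.univ : Finset (Fin n × Fin n)).filter fun p => p.1 = p.2 := by
    ext p; simp only [Finset.mem_filter, Finset.mem_univ, true_and]
    constructor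
    · exact fun h => h.2
    · exact fun h => ⟨by rw [h]; exact lt_irrefl _, h⟩
  have h7 : ((Finset.univ : Finset (Fin n × Fin n)).filter fun p => ¬ p.1 < p.2 ∧ ¬ p.1 = p.2) =
      (Finset.univ : Finset (Fin n × Fin n)).filter fun p => p.2 < p.1 := by
    ext p; simp only [Finset.mem_filter, Finset.mem_univ, true_and, Fin.lt_def, Fin.ext_iff]
    omega
  rw [h6, h7] at h5
  simp only [Finset.card_univ, Fintype.card_prod, Fintype.card_fin] at h4
  omega

/-- After `h` edges the graph beyond some initial part of the greedy path is disconnected although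
many vertices are left. -/
def Unlucky (σ : EdgeOrder n) (h : ℕ) : Prop :=
  ∃ w, w.Nodup ∧ GreedyPath σ w ∧ ∃ X ⊆ rest w, X.Nonempty ∧ 2 * X.card ≤ (rest w).card ∧
    3 * (n : ℝ) ^ 2 * Real.log n ≤ h * (rest w).card ∧ σ ∈ avoiding (crossing X (rest w)) h

theorem card_edgeOrder_pos (n : ℕ) : (0 : ℝ) < Fintype.card (EdgeOrder n) := by
  have : Nonempty (EdgeOrder n) := ⟨(Fintype.equivFin (Edge n)).symm⟩
  exact Nat.cast_pos.2 Fintype.card_pos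

open Classical in
-- Edges of the cut have no end on `w`. Hence missing the cut concerns positions outside `A`, the
-- set of edges touching `w`, while following `w` concerns only the relative order inside `A`: the
-- events are independent.
theorem card_greedyPath_avoiding_le {w : List (Fin (n + 1))} {X : Finset (Fin n)}
    (hX : X ⊆ rest w) {h : ℕ} (hh : h ≤ Fintype.card (Edge n)) :
    (((Finset.univ : Finset (EdgeOrder n)).filter fun σ =>
      GreedyPath σ w ∧ σ ∈ avoiding (crossing X (rest w)) h).card : ℝ) ≤
      Real.exp (-(h * (crossing X (rest w)).card / Fintype.card (Edge n))) *
        ((Finset.univ : Finset (EdgeOrder n)).filter fun σ => GreedyPath σ w).card := by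
  set F := crossing X (rest w) with hF
  let A : Finset (Edge n) := Finset.univ.filter fun e => ∃ x u, x ∈ w ∧ Joins e x u
  have hA : ∀ e x u, x ∈ w → Joins e x u → e ∈ A := fun e x u hx hj => by
    simp only [A, Finset.mem_filter, Finset.mem_univ, true_and]
    exact ⟨x, u, hx, hj⟩
  have hFA : ∀ e ∈ F, e ∉ A := by
    intro e he heA
    simp only [A, Finset.mem_filter, Finset.mem_univ, true_and] at heA
    obtain ⟨x, u, hx, hj⟩ := heA
    have he' : e.1.1 ∈ rest w ∧ e.1.2 ∈ rest w := by
      rcases mem_crossing.1 he with ⟨h1, h2⟩ | ⟨h1, h2⟩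
      · exact ⟨hX h1, (Finset.mem_sdiff.1 h2).1⟩
      · exact ⟨(Finset.mem_sdiff.1 h2).1, hX h1⟩
    rw [mem_rest, mem_rest] at he'
    rcases hj with ⟨rfl, -⟩ | ⟨rfl, -⟩
    · exact he'.1 hx
    · exact he'.2 hx
  have key := card_mul_sum_mul A (f := fun σ => if GreedyPath σ w then (1 : ℝ) else 0)
    (g := fun σ => if σ ∈ avoiding F h then (1 : ℝ) else 0)
    (fun σ τ hst => by
      have : GreedyPath σ w ↔ GreedyPath τ w :=
        ⟨GreedyPath.congr hA hst, GreedyPath.congr hA fun e he e' he' => (hst e he e' he').symm⟩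
      simp only [this])
    (fun σ τ hst => by
      have h' : ∀ ρ : EdgeOrder n, ρ ∈ avoiding F h ↔ ∀ e ∈ F, h ≤ (ρ.symm e).val := fun ρ => by
        rw [mem_avoiding]
        constructor
        · intro h1 e he
          by_contra! hlt
          exact h1 _ hlt (by simpa using he)
        · intro h1 l hl hlF
          have := h1 _ hlF
          rw [Equiv.symm_apply_apply] at this
          omega
      have : σ ∈ avoiding F h ↔ τ ∈ avoiding F h := by
        rw [h', h']
        exact forall₂_congr fun e he => by rw [hst e (hFA e he)]
      simp only [this])
  simp only [← ite_and, mul_ite, mul_one, mul_zero] at key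
  rw [Finset.sum_boole, Finset.sum_boole, Finset.sum_boole] at key
  have hav := card_avoiding_le F hh
  have hpos := card_edgeOrder_pos n
  have h1 : (Finset.univ.filter fun σ : EdgeOrder n => σ ∈ avoiding F h) = avoiding F h := by
    ext; simp
  have h2 : (Finset.univ.filter fun σ : EdgeOrder n => σ ∈ avoiding F h ∧ GreedyPath σ w) =
      Finset.univ.filter fun σ : EdgeOrder n => GreedyPath σ w ∧ σ ∈ avoiding F h := by
    ext; simp [and_comm]
  rw [h1, h2] at key
  refine le_of_mul_le_mul_left ?_ hpos
  rw [key]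
  calc _ ≤ (((Finset.univ : Finset (EdgeOrder n)).filter fun σ => GreedyPath σ w).card : ℝ) *
        (Real.exp (-(h * F.card / Fintype.card (Edge n))) * Fintype.card (EdgeOrder n)) := by
        gcongr
    _ = _ := by ring

open Classical in
-- A path without repetition has length at most `n + 1`, and each length occurs at most once for
-- each ordering.
theorem sum_card_greedyPath_le (n : ℕ) :
    ∑ w : {w : List (Fin (n + 1)) // w.Nodup},
      (((Finset.univ : Finset (EdgeOrder n)).filter fun σ => GreedyPath σ w.1).card : ℝ) ≤
      (n + 2) * Fintype.card (EdgeOrder n) := by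
  simp only [← Finset.sum_boole]
  rw [Finset.sum_comm]
  refine (Finset.sum_le_card_nsmul Finset.univ _ ((n : ℝ) + 2) fun σ _ => ?_).trans_eq
    (by rw [Finset.card_univ, nsmul_eq_mul, mul_comm])
  rw [Finset.sum_boole]
  have h := Finset.card_le_card_of_injOn
    (s := Finset.univ.filter fun w : {w : List (Fin (n + 1)) // w.Nodup} => GreedyPath σ w.1)
    (t := Finset.range (n + 2)) (fun w => w.1.length)
    (fun w _ => by
      have := w.2.length_le_card
      simp only [Fintype.card_fin] at this
      simp only [Finset.coe_range, Set.mem_Iio]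
      omega)
    (fun w hw w' hw' hl => Subtype.ext
      (GreedyPath.unique (by simpa using hw) (by simpa using hw') hl))
  rw [Finset.card_range] at h
  exact_mod_cast h

/-- With `f ≥ k r / 2` and at most `n² / 2` possible edges, the exponent is at least `k h r / n² ≥ 3
k log n`. -/
theorem exp_neg_le_pow (hn : 2 ≤ n) {h r f k : ℕ} (hf : k * r ≤ 2 * f)
    (hr : 3 * (n : ℝ) ^ 2 * Real.log n ≤ h * r) :
    Real.exp (-(h * f / Fintype.card (Edge n))) ≤ (((n : ℝ) ^ 3)⁻¹) ^ k := by
  have hnpos : (0 : ℝ) < n := by exact_mod_cast (by omega : 0 < n)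
  have hx : ((n : ℝ) ^ 3)⁻¹ = Real.exp (-(3 * Real.log n)) := by
    rw [Real.exp_neg, mul_comm, Real.exp_mul, Real.exp_log hnpos]
    norm_cast
  rw [hx, ← Real.exp_nat_mul]
  refine Real.exp_le_exp.2 ?_
  have hN := two_mul_card_edge n
  have hN' : 2 * (Fintype.card (Edge n) : ℝ) + n = (n : ℝ) ^ 2 := by
    rw [sq]; exact_mod_cast hN
  have hNpos : (0 : ℝ) < Fintype.card (Edge n) := by
    have : (2 : ℝ) ≤ n := by exact_mod_cast hn
    nlinarith
  have hf' : (k : ℝ) * r ≤ 2 * f := by exact_mod_cast hf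
  rw [mul_neg, neg_le_neg_iff, le_div_iff₀ hNpos]
  have hlog : 0 ≤ Real.log n := Real.log_natCast_nonneg n
  have hk : (0 : ℝ) ≤ k := Nat.cast_nonneg k
  have hh : (0 : ℝ) ≤ h := Nat.cast_nonneg h
  have e1 : (k : ℝ) * (3 * (n : ℝ) ^ 2 * Real.log n) ≤ k * (h * r) :=
    mul_le_mul_of_nonneg_left hr hk
  have e2 : (h : ℝ) * (k * r) ≤ h * (2 * f) := mul_le_mul_of_nonneg_left hf' hh
  have e3 : (k : ℝ) * (3 * Real.log n) * (2 * Fintype.card (Edge n)) ≤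
      k * (3 * Real.log n) * (n : ℝ) ^ 2 :=
    mul_le_mul_of_nonneg_left (by linarith) (by positivity)
  linarith

theorem sum_pow_card_le (hn : 2 ≤ n) (R : Finset (Fin n)) :
    ∑ X ∈ R.powerset.filter Finset.Nonempty, (((n : ℝ) ^ 3)⁻¹) ^ X.card ≤ 2 / (n : ℝ) ^ 2 := by
  have hn2 : (2 : ℝ) ≤ n := by exact_mod_cast hn
  set x := ((n : ℝ) ^ 3)⁻¹ with hx
  have hxpos : 0 < x := by positivity
  -- By the binomial theorem the sum is `(1 + n⁻³)^|R| - 1`, which is at most `exp (n⁻²) - 1`.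
  have h1 := Finset.sum_pow_mul_eq_add_pow x 1 R
  simp only [one_pow, mul_one] at h1
  have h2 : ∑ X ∈ R.powerset.filter Finset.Nonempty, x ^ X.card + 1 =
      ∑ X ∈ R.powerset, x ^ X.card := by
    rw [← Finset.sum_filter_add_sum_filter_not R.powerset Finset.Nonempty]
    congr 1
    have : R.powerset.filter (fun X => ¬ X.Nonempty) = {∅} := by
      ext X
      simp only [Finset.mem_filter, Finset.mem_powerset, Finset.not_nonempty_iff_eq_empty,
        Finset.mem_singleton]
      exact ⟨fun h => h.2, fun h => ⟨h ▸ Finset.empty_subset R, h⟩⟩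
    rw [this]
    simp
  have h3 : (x + 1) ^ R.card ≤ Real.exp (R.card * x) := by
    rw [Real.exp_nat_mul]
    gcongr
    exact Real.add_one_le_exp x
  have h4 : (R.card : ℝ) * x ≤ 1 / (n : ℝ) ^ 2 := by
    have : (R.card : ℝ) ≤ n := by
      have := Finset.card_le_univ R
      rw [Fintype.card_fin] at this
      exact_mod_cast this
    calc (R.card : ℝ) * x ≤ n * x := by gcongr
      _ = 1 / (n : ℝ) ^ 2 := by rw [hx]; field_simp
  have h5 : (1 : ℝ) / (n : ℝ) ^ 2 ≤ 1 := by
    rw [div_le_one (by positivity)]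
    nlinarith
  have h6 : 0 ≤ (R.card : ℝ) * x := by positivity
  have h7 := Real.abs_exp_sub_one_le (x := (R.card : ℝ) * x)
    (by rw [abs_of_nonneg h6]; linarith)
  rw [abs_of_nonneg h6] at h7
  have h8 := (abs_le.1 h7).2
  have h9 : (2 : ℝ) / (n : ℝ) ^ 2 = 2 * (1 / (n : ℝ) ^ 2) := by ring
  linarith

open Classical in
-- By independence the sum over cuts costs a factor `2 / n²` for each path, and the probabilities of
-- the paths sum to at most `n + 2 ≤ 2 n`.
theorem card_unlucky_le (hn : 2 ≤ n) {h : ℕ} (hh : h ≤ Fintype.card (Edge n)) :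
    (((Finset.univ : Finset (EdgeOrder n)).filter fun σ => Unlucky σ h).card : ℝ) ≤
      4 / n * Fintype.card (EdgeOrder n) := by
  let P (w : List (Fin (n + 1))) : Finset (Finset (Fin n)) :=
    ((rest w).powerset.filter Finset.Nonempty).filter fun X => 2 * X.card ≤ (rest w).card ∧
      3 * (n : ℝ) ^ 2 * Real.log n ≤ h * (rest w).card
  have hP : ∀ w X, X ∈ P w ↔ (X ⊆ rest w ∧ X.Nonempty) ∧ 2 * X.card ≤ (rest w).card ∧
      3 * (n : ℝ) ^ 2 * Real.log n ≤ h * (rest w).card := fun w X => by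
    simp only [P, Finset.mem_filter, Finset.mem_powerset]
  have hsub : ((Finset.univ : Finset (EdgeOrder n)).filter fun σ => Unlucky σ h) ⊆
      (Finset.univ : Finset {w : List (Fin (n + 1)) // w.Nodup}).biUnion fun w =>
        (P w.1).biUnion fun X => (Finset.univ : Finset (EdgeOrder n)).filter fun σ =>
          GreedyPath σ w.1 ∧ σ ∈ avoiding (crossing X (rest w.1)) h := by
    intro σ hσ
    obtain ⟨w, hw, hg, X, hX, hne, h2, h3, hav⟩ := (Finset.mem_filter.1 hσ).2
    simp only [Finset.mem_biUnion, Finset.mem_univ, true_and, Finset.mem_filter]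
    exact ⟨⟨w, hw⟩, X, (hP _ _).2 ⟨⟨hX, hne⟩, h2, h3⟩, hg, hav⟩
  have hterm : ∀ w : List (Fin (n + 1)), ∀ X ∈ P w,
      (((Finset.univ : Finset (EdgeOrder n)).filter fun σ =>
        GreedyPath σ w ∧ σ ∈ avoiding (crossing X (rest w)) h).card : ℝ) ≤
      (((n : ℝ) ^ 3)⁻¹) ^ X.card *
        ((Finset.univ : Finset (EdgeOrder n)).filter fun σ => GreedyPath σ w).card := by
    intro w X hX
    obtain ⟨⟨h1, -⟩, h2, h3⟩ := (hP _ _).1 hX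
    refine (card_greedyPath_avoiding_le h1 hh).trans ?_
    gcongr
    refine exp_neg_le_pow hn ?_ h3
    have e1 := card_mul_card_le_card_crossing X (rest w)
    rw [Finset.card_sdiff_of_subset h1] at e1
    have e2 : (rest w).card ≤ 2 * ((rest w).card - X.card) := by omega
    calc X.card * (rest w).card ≤ X.card * (2 * ((rest w).card - X.card)) :=
          Nat.mul_le_mul_left _ e2
      _ = 2 * (X.card * ((rest w).card - X.card)) := by ring
      _ ≤ _ := Nat.mul_le_mul_left _ e1
  have hw : ∀ w : List (Fin (n + 1)),
      ((((P w).biUnion fun X => (Finset.univ : Finset (EdgeOrder n)).filter fun σ =>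
          GreedyPath σ w ∧ σ ∈ avoiding (crossing X (rest w)) h).card : ℕ) : ℝ) ≤
      2 / (n : ℝ) ^ 2 *
        ((Finset.univ : Finset (EdgeOrder n)).filter fun σ => GreedyPath σ w).card := by
    intro w
    refine (Nat.cast_le.2 Finset.card_biUnion_le).trans ?_
    rw [Nat.cast_sum]
    refine (Finset.sum_le_sum (hterm w)).trans ?_
    rw [← Finset.sum_mul]
    refine mul_le_mul_of_nonneg_right ?_ (Nat.cast_nonneg _)
    refine le_trans ?_ (sum_pow_card_le hn (rest w))
    exact Finset.sum_le_sum_of_subset_of_nonneg (Finset.filter_subset _ _)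
      fun _ _ _ => by positivity
  have hn2 : (2 : ℝ) ≤ n := by exact_mod_cast hn
  calc (((Finset.univ : Finset (EdgeOrder n)).filter fun σ => Unlucky σ h).card : ℝ)
      ≤ ∑ w : {w : List (Fin (n + 1)) // w.Nodup}, 2 / (n : ℝ) ^ 2 *
        ((Finset.univ : Finset (EdgeOrder n)).filter fun σ => GreedyPath σ w.1).card := by
        refine (Nat.cast_le.2 ((Finset.card_le_card hsub).trans Finset.card_biUnion_le)).trans ?_
        rw [Nat.cast_sum]
        exact Finset.sum_le_sum fun w _ => hw w.1
    _ ≤ 2 / (n : ℝ) ^ 2 * ((n + 2) * Fintype.card (EdgeOrder n)) := by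
        rw [← Finset.mul_sum]
        exact mul_le_mul_of_nonneg_left (sum_card_greedyPath_le n) (by positivity)
    _ ≤ 4 / n * Fintype.card (EdgeOrder n) := by
        rw [← mul_assoc]
        refine mul_le_mul_of_nonneg_right ?_ (card_edgeOrder_pos n).le
        rw [div_mul_eq_mul_div, div_le_div_iff₀ (by positivity) (by positivity)]
        nlinarith

open Classical in
/-- The edges that avoid the stick of the tree maintained for `L`. -/
noncomputable def freeEdges (L : List (Edge n)) : Finset (Edge n) :=
  Finset.univ.filter fun e => ¬ (dfsAlgorithm.run L).TouchesStick e

theorem mem_freeEdges {L : List (Edge n)} {e : Edge n} :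
    e ∈ freeEdges L ↔ ¬ (dfsAlgorithm.run L).TouchesStick e := by
  simp [freeEdges]

/-- If the tree branches below its trunk, then the vertices below are separated. -/
theorem exists_separated {L : List (Edge n)} {M : Memory n}
    (hM : IsDFSTree (augGraph L) (Fin.last n) M.par) {b : Fin (n + 1)} {w : List (Fin (n + 1))}
    (hw : Trunk (Fin.last n) M.par (b :: w)) (hb : ¬ ∃! c, IsChild (Fin.last n) M.par c b)
    (hne : (rest (b :: w)).Nonempty) :
    ∃ X ⊆ rest (b :: w), X.Nonempty ∧ 2 * X.card ≤ (rest (b :: w)).card ∧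
      ∀ e ∈ L, e ∉ crossing X (rest (b :: w)) := by
  classical
  have hT := hM.isRooted
  obtain ⟨v, hv⟩ := hne
  rw [mem_rest] at hv
  obtain ⟨c₁, hc₁, -⟩ := hT.exists_child
    (hw.isAncestor_of_notMem hT fun h => hv (List.mem_cons_of_mem _ h))
    (fun h => hv (h ▸ List.mem_cons_self))
  -- Having a child but not exactly one, `b` has a second child, so the subtree of `c₁` is not all
  -- that is left.
  obtain ⟨c₂, hc₂, hne⟩ : ∃ c₂, IsChild (Fin.last n) M.par c₂ b ∧ c₂ ≠ c₁ := by
    by_contra! hcon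
    exact hb ⟨c₁, hc₁, hcon⟩
  have hchild : ∀ c, IsChild (Fin.last n) M.par c b → c ∉ b :: w := by
    intro c hc
    rw [hw.mem_iff hT]
    intro h
    have := hT.antisymm h (hc.2 ▸ isAncestor_par c)
    exact hT.par_ne hc.1 (hc.2.trans this.symm)
  let X : Finset (Fin n) := Finset.univ.filter fun v => IsAncestor M.par c₁ v.castSucc
  have hX : ∀ v, v ∈ X ↔ IsAncestor M.par c₁ v.castSucc := fun v => by simp [X]
  have hXR : X ⊆ rest (b :: w) := by
    intro v hv
    rw [mem_rest, hw.mem_iff hT]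
    intro h
    exact hchild c₁ hc₁ ((hw.mem_iff hT).2 (((hX v).1 hv).trans h))
  have hsep : ∀ e ∈ L, e ∉ crossing X (rest (b :: w)) := by
    intro e he hcr
    have key : ∀ u v : Fin n, u ∈ X → v ∈ rest (b :: w) \ X →
        ¬ (IsAncestor M.par u.castSucc v.castSucc ∨ IsAncestor M.par v.castSucc u.castSucc) := by
      intro u v hu hv
      rw [Finset.mem_sdiff, hX, mem_rest] at hv
      rw [hX] at hu
      rintro (h | h)
      · exact hv.2 (hu.trans h)
      · rcases IsAncestor.total hu h with h' | h'
        · exact hv.2 h'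
        · rcases isAncestor_iff.1 h' with h'' | h''
          · exact hv.2 (h'' ▸ IsAncestor.refl _)
          · rw [hc₁.2] at h''
            exact hv.1 ((hw.mem_iff hT).2 h'')
    have hcomp := hM.no_cross _ _ (augGraph_adj.2
      ⟨(joins_self e).ne, Or.inr (Or.inr ⟨e, he, joins_self e⟩)⟩)
    rcases mem_crossing.1 hcr with ⟨h1, h2⟩ | ⟨h1, h2⟩
    · exact key _ _ h1 h2 hcomp
    · exact key _ _ h1 h2 hcomp.symm
  obtain ⟨v₁, rfl⟩ := Fin.exists_castSucc_eq.2 hc₁.1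
  obtain ⟨v₂, rfl⟩ := Fin.exists_castSucc_eq.2 hc₂.1
  have hv₁ : v₁ ∈ X := (hX _).2 (IsAncestor.refl _)
  have hv₂ : v₂ ∈ rest (b :: w) \ X := by
    rw [Finset.mem_sdiff, mem_rest, hX]
    refine ⟨hchild _ hc₂, fun h => ?_⟩
    rcases isAncestor_iff.1 h with h' | h'
    · exact hne h'.symm
    · rw [hc₂.2] at h'
      exact hchild _ hc₁ ((hw.mem_iff hT).2 h')
  have hcard := Finset.card_sdiff_add_card_eq_card hXR
  by_cases hle : 2 * X.card ≤ (rest (b :: w)).card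
  · exact ⟨X, hXR, ⟨v₁, hv₁⟩, hle, hsep⟩
  -- If the subtree of `c₁` exceeds half, its complement serves, with the same crossing edges.
  · refine ⟨rest (b :: w) \ X, Finset.sdiff_subset, ⟨v₂, hv₂⟩, by omega, ?_⟩
    rw [crossing_sdiff hXR]
    exact hsep

/-- Take `r` to be the number of vertices outside a maximal trunk. If it were too large, the
branching below the trunk would witness bad luck. Free edges have both ends outside the stick, that
is, among these `r` vertices and the branching vertex `b`. -/
theorem card_freeEdges_le {σ : EdgeOrder n} {h : ℕ} (hσ : ¬ Unlucky σ h) :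
    ∃ r : ℕ, (h : ℝ) * r ≤ 3 * (n : ℝ) ^ 2 * Real.log n ∧
      (freeEdges (firstEdges σ h)).card ≤ (r + 1) ^ 2 := by
  classical
  have hM := invariant_run (firstEdges σ h)
  set M := dfsAlgorithm.run (firstEdges σ h) with hMdef
  have hT := hM.isDFSTree.isRooted
  obtain ⟨b, w, hw, hb⟩ := Trunk.exists_maximal hT
  refine ⟨(rest (b :: w)).card, ?_, ?_⟩
  · rcases (rest (b :: w)).eq_empty_or_nonempty with h0 | hne
    · rw [h0]
      have := Real.log_natCast_nonneg n
      simp only [Finset.card_empty, Nat.cast_zero, mul_zero]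
      positivity
    · obtain ⟨X, hX, hXne, h2, hsep⟩ := exists_separated hM.isDFSTree hw hb hne
      by_contra! hlt
      refine hσ ⟨b :: w, hw.nodup hT, hM.greedyPath hw, X, hX, hXne, h2, hlt.le, ?_⟩
      rw [mem_avoiding]
      intro l hl
      refine hsep _ ?_
      rw [firstEdges, List.mem_take_iff_getElem]
      exact ⟨l.val, by simp [hl], by simp⟩
  · let B : Finset (Fin n) := Finset.univ.filter fun v => v.castSucc ∉ w
    have hB : B.card ≤ (rest (b :: w)).card + 1 := by
      have hsub : B.image Fin.castSucc ⊆ insert b ((rest (b :: w)).image Fin.castSucc) := by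
        intro x hx
        obtain ⟨v, hv, rfl⟩ := Finset.mem_image.1 hx
        rw [Finset.mem_insert]
        by_cases hvb : v.castSucc = b
        · exact Or.inl hvb
        · refine Or.inr (Finset.mem_image_of_mem _ (mem_rest.2 ?_))
          rw [List.mem_cons, not_or]
          exact ⟨hvb, (Finset.mem_filter.1 hv).2⟩
      have h1 := Finset.card_le_card hsub
      rw [Finset.card_image_of_injective _ (Fin.castSucc_injective n)] at h1
      refine h1.trans ((Finset.card_insert_le _ _).trans ?_)
      exact Nat.add_le_add_right Finset.card_image_le 1
    calc (freeEdges (firstEdges σ h)).card ≤ (B ×ˢ B).card := by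
          refine Finset.card_le_card_of_injOn (fun e => e.1) (fun e he => ?_)
            (Subtype.val_injective.injOn)
          have he' := mem_freeEdges.1 (Finset.mem_coe.1 he)
          rw [← hMdef, Memory.TouchesStick, hw.onStick_iff hT hb, hw.onStick_iff hT hb,
            not_or] at he'
          simp only [B, Finset.coe_product, Set.mem_prod, Finset.coe_filter, Finset.mem_univ,
            true_and, Set.mem_ofPred_eq]
          exact he'
      _ ≤ _ := by
          rw [Finset.card_product, sq]
          exact Nat.mul_le_mul hB hB

end Greedy

end SemiStream

namespace SemiStream

/-! ### The expected space -/

section Space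

variable {n : ℕ}

theorem firstEdges_append {σ : EdgeOrder n} {h t : ℕ} (hht : h ≤ t) :
    firstEdges σ h ++ (firstEdges σ t).drop h = firstEdges σ t := by
  conv_rhs => rw [← List.take_append_drop h (firstEdges σ t)]
  rw [firstEdges, firstEdges, List.take_take, min_eq_left hht]

theorem firstEdges_congr {σ τ : EdgeOrder n} {h : ℕ} (hst : ∀ l, l.val < h → σ l = τ l) :
    firstEdges σ h = firstEdges τ h := by
  apply List.ext_getElem
  · simp [firstEdges]
  · intro i h1 _
    simp only [firstEdges, List.getElem_take, List.getElem_ofFn]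
    refine hst _ ?_
    simp only [firstEdges, List.length_take] at h1
    exact (lt_min_iff.1 h1).1

open Classical in
/-- The positions from `s` on at which an edge arrives that avoids the stick as it was after half
of the time. -/
noncomputable def lateFree (s : ℕ) (σ : EdgeOrder n) : Finset (Fin (Fintype.card (Edge n))) :=
  (Finset.univ.filter (s ≤ ·.val)).filter fun i => σ i ∈ freeEdges (firstEdges σ (i.val / 2))

/-- A stored edge avoids the present stick, hence also the smaller stick at half its arrival time.
The bound is the same for all `t`. -/
theorem length_stored_le (s : ℕ) (σ : EdgeOrder n) (t : ℕ) (hs : 0 < s) :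
    (dfsAlgorithm.run (firstEdges σ t)).stored.length ≤ s + (lateFree s σ).card := by
  classical
  have hM := invariant_run (firstEdges σ t)
  have hnodup : (dfsAlgorithm.run (firstEdges σ t)).stored.Nodup := by
    rw [hM.stored_eq]
    exact (List.Sublist.nodup (List.take_sublist _ _)
      (List.nodup_ofFn_ofInjective σ.injective)).filter _
  rw [← List.toFinset_card_of_nodup hnodup]
  have hsub : (dfsAlgorithm.run (firstEdges σ t)).stored.toFinset ⊆
      ((Finset.univ.filter (·.val < s)) ∪ lateFree s σ).map σ.toEmbedding := by
    intro e he
    rw [List.mem_toFinset] at he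
    have heL := hM.stored_subset he
    obtain ⟨i, hi, hie⟩ := List.mem_take_iff_getElem.1 heL
    simp only [List.length_ofFn, lt_min_iff] at hi
    rw [List.getElem_ofFn] at hie
    rw [Finset.mem_map]
    refine ⟨⟨i, hi.2⟩, ?_, hie⟩
    rw [Finset.mem_union, Finset.mem_filter]
    by_cases his : i < s
    · exact Or.inl ⟨Finset.mem_univ _, his⟩
    · refine Or.inr ?_
      rw [lateFree, Finset.mem_filter, Finset.mem_filter]
      refine ⟨⟨Finset.mem_univ _, not_lt.1 his⟩, ?_⟩
      rw [mem_freeEdges, hie]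
      intro htouch
      refine notMem_stored_run ?_ he
      rw [← firstEdges_append (σ := σ) (h := i / 2) (t := t) (by omega)]
      exact touchesStick_run_append htouch _
  refine (Finset.card_le_card hsub).trans ?_
  rw [Finset.card_map]
  refine (Finset.card_union_le _ _).trans (Nat.add_le_add_right ?_ _)
  rw [Fin.card_filter_val_lt]
  exact min_le_right _ _

theorem peakSpace_le {s : ℕ} (hs : 0 < s) (σ : EdgeOrder n) (m : ℕ) :
    dfsAlgorithm.peakSpace (firstEdges σ m) ≤ n + 2 * (s + (lateFree s σ).card) := by
  refine Finset.sup_le fun t _ => ?_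
  have : (firstEdges σ m).take t = firstEdges σ (min t m) := by
    rw [firstEdges, firstEdges, List.take_take]
  rw [this, Memory.space]
  have := length_stored_le s σ (min t m) hs
  omega

/-- Lucky orderings contribute `(r + 1)² ≤ 2 r² + 2`; unlucky ones contribute at most all edges,
with probability at most `4 / n`. -/
theorem sum_card_freeEdges_le (hn : 2 ≤ n) {h : ℕ} (hh : 0 < h)
    (hhN : h ≤ Fintype.card (Edge n)) :
    ∑ σ : EdgeOrder n, ((freeEdges (firstEdges σ h)).card : ℝ) ≤
      (2 * (3 * (n : ℝ) ^ 2 * Real.log n / h) ^ 2 + 2 + Fintype.card (Edge n) * (4 / n)) *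
        Fintype.card (EdgeOrder n) := by
  classical
  set ρ := 3 * (n : ℝ) ^ 2 * Real.log n / h with hρ
  set N := Fintype.card (Edge n) with hN
  have hpoint : ∀ σ : EdgeOrder n, ((freeEdges (firstEdges σ h)).card : ℝ) ≤
      (2 * ρ ^ 2 + 2) + N * (if Unlucky σ h then 1 else 0) := by
    intro σ
    by_cases hσ : Unlucky σ h
    · rw [if_pos hσ]
      have h1 : ((freeEdges (firstEdges σ h)).card : ℝ) ≤ N :=
        Nat.cast_le.2 (Finset.card_le_univ _)
      have : 0 ≤ ρ ^ 2 := sq_nonneg ρ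
      linarith
    · rw [if_neg hσ]
      obtain ⟨r, h1, h2⟩ := card_freeEdges_le hσ
      have h2' : ((freeEdges (firstEdges σ h)).card : ℝ) ≤ ((r : ℝ) + 1) ^ 2 := by
        exact_mod_cast h2
      have h3 : (r : ℝ) ≤ ρ := by
        rw [hρ, le_div_iff₀ (by exact_mod_cast hh), mul_comm]
        exact h1
      have h4 : (r : ℝ) ^ 2 ≤ ρ ^ 2 := by gcongr
      nlinarith [sq_nonneg ((r : ℝ) - 1)]
  refine (Finset.sum_le_sum fun σ _ => hpoint σ).trans ?_
  rw [Finset.sum_add_distrib, Finset.sum_const, Finset.card_univ, nsmul_eq_mul,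
    ← Finset.mul_sum, Finset.sum_boole]
  have h1 := card_unlucky_le hn hhN
  have h2 : (N : ℝ) * ((Finset.univ : Finset (EdgeOrder n)).filter fun σ => Unlucky σ h).card ≤
      N * (4 / n * Fintype.card (EdgeOrder n)) :=
    mul_le_mul_of_nonneg_left h1 (Nat.cast_nonneg _)
  linarith

/-- Waiting only until half of the time leaves at least `N / 2` edges for position `i` to be uniform
on, and costs only a constant factor in the size of the free set. -/
theorem sum_mem_freeEdges_le (hn : 2 ≤ n) (i : Fin (Fintype.card (Edge n))) (hi : 2 ≤ i.val) :
    ∑ σ : EdgeOrder n,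
      (if σ i ∈ freeEdges (firstEdges σ (i.val / 2)) then (1 : ℝ) else 0) ≤
      (36 * (3 * (n : ℝ) ^ 2 * Real.log n) ^ 2 / Fintype.card (Edge n) * ((i.val : ℝ) ^ 2)⁻¹ +
        (4 / Fintype.card (Edge n) + 8 / n)) * Fintype.card (EdgeOrder n) := by
  set h := i.val / 2 with hh
  have hiN := i.2
  have h1 := mul_sum_mem_le (α := Edge n) (k := h) (F := fun σ => freeEdges (firstEdges σ h))
    (fun σ τ hst => by rw [firstEdges_congr hst]) (i := i) (by omega)
  have h2 := sum_card_freeEdges_le hn (h := h) (by omega) (by omega)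
  set S := ∑ σ : EdgeOrder n, (if σ i ∈ freeEdges (firstEdges σ h) then (1 : ℝ) else 0) with hS
  have hS0 : 0 ≤ S := Finset.sum_nonneg fun σ _ => by split_ifs <;> norm_num
  have hNpos : (0 : ℝ) < Fintype.card (Edge n) := by
    exact_mod_cast (by omega : 0 < Fintype.card (Edge n))
  have hhalf : (Fintype.card (Edge n) : ℝ) / 2 ≤ Fintype.card (Edge n) - h := by
    have : (2 : ℝ) * h ≤ Fintype.card (Edge n) := by exact_mod_cast (by omega : 2 * h ≤ Fintype.card (Edge n))
    linarith
  have h3 : (Fintype.card (Edge n) : ℝ) / 2 * S ≤ _ :=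
    (mul_le_mul_of_nonneg_right hhalf hS0).trans (h1.trans h2)
  set E : ℝ := ((Fintype.card (EdgeOrder n) : ℕ) : ℝ) with hE
  have hEpos : 0 < E := card_edgeOrder_pos n
  set a := 3 * (n : ℝ) ^ 2 * Real.log n with ha
  have hipos : (0 : ℝ) < i.val := by exact_mod_cast (by omega : 0 < i.val)
  have hhpos : (0 : ℝ) < h := by exact_mod_cast (by omega : 0 < h)
  have h4 : (a / h) ^ 2 ≤ 9 * a ^ 2 * ((i.val : ℝ) ^ 2)⁻¹ := by
    -- Rounding down in `h = i / 2` is harmless for `i ≥ 2`; the factor `9 = 3²` comes from here.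
    have hi3 : (i.val : ℝ) ≤ 3 * h := by exact_mod_cast (by omega : i.val ≤ 3 * h)
    rw [div_pow, ← div_eq_mul_inv, div_le_div_iff₀ (by positivity) (by positivity)]
    have : (i.val : ℝ) ^ 2 ≤ (3 * h) ^ 2 := by gcongr
    nlinarith [sq_nonneg a]
  have h5 : (Fintype.card (Edge n) : ℝ) / 2 * S ≤ (2 * (9 * a ^ 2 * ((i.val : ℝ) ^ 2)⁻¹) + 2 + Fintype.card (Edge n) * (4 / n)) * E :=
    h3.trans (by gcongr)
  have hnpos : (0 : ℝ) < n := by exact_mod_cast (by omega : 0 < n)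
  calc S = 2 / Fintype.card (Edge n) * (Fintype.card (Edge n) / 2 * S) := by field_simp
    _ ≤ 2 / Fintype.card (Edge n) * ((2 * (9 * a ^ 2 * ((i.val : ℝ) ^ 2)⁻¹) + 2 + Fintype.card (Edge n) * (4 / n)) * E) := by gcongr
    _ = _ := by field_simp; ring

theorem sum_inv_sq_le {s N : ℕ} (hs : 2 ≤ s) :
    ∑ i ∈ (Finset.univ : Finset (Fin N)).filter (s ≤ ·.val), ((i.val : ℝ) ^ 2)⁻¹ ≤
      ((s - 1 : ℕ) : ℝ)⁻¹ := by
  have h1 : ∑ i ∈ (Finset.univ : Finset (Fin N)).filter (s ≤ ·.val), ((i.val : ℝ) ^ 2)⁻¹ =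
      ∑ j ∈ ((Finset.univ : Finset (Fin N)).filter (s ≤ ·.val)).map Fin.valEmbedding,
        ((j : ℝ) ^ 2)⁻¹ := by
    rw [Finset.sum_map]
    rfl
  have h2 : ((Finset.univ : Finset (Fin N)).filter (s ≤ ·.val)).map Fin.valEmbedding ⊆
      Finset.Ioc (s - 1) (s - 1 + N) := by
    intro j hj
    simp only [Finset.mem_map, Finset.mem_filter, Finset.mem_univ, true_and] at hj
    obtain ⟨i, hi, rfl⟩ := hj
    have := i.2
    rw [Finset.mem_Ioc]
    simp only [Fin.valEmbedding_apply]
    omega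
  rw [h1]
  refine (Finset.sum_le_sum_of_subset_of_nonneg h2 fun _ _ _ => by positivity).trans ?_
  refine (sum_Ioc_inv_sq_le_sub (by omega) (by omega)).trans ?_
  have : (0 : ℝ) ≤ ((s - 1 + N : ℕ) : ℝ)⁻¹ := by positivity
  linarith

/-- Here `x` is `n`, `l` is `log n`, and `c` counts the late positions. The first term uses `N ≥ x²
/ 4`, the second `2 N ≤ x²`. -/
theorem late_sum_le {x l N S c : ℝ} (hx : 2 ≤ x) (hl : 0 < l) (hN : 2 * N + x = x ^ 2)
    (hS : S ≤ (x * l)⁻¹) (hS0 : 0 ≤ S) (hc : c ≤ N) :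
    36 * (3 * x ^ 2 * l) ^ 2 / N * S + c * (4 / N + 8 / x) ≤ 1296 * (x * l) + 4 + 4 * x := by
  have hx0 : 0 < x := by linarith
  have hNlow : x ^ 2 / 4 ≤ N := by nlinarith
  have hNpos : 0 < N := lt_of_lt_of_le (by positivity) hNlow
  have h1 : 36 * (3 * x ^ 2 * l) ^ 2 / N * S ≤ 1296 * (x * l) := by
    calc _ ≤ 36 * (3 * x ^ 2 * l) ^ 2 / (x ^ 2 / 4) * (x * l)⁻¹ := by gcongr
      _ = _ := by field_simp; ring
  have h2 : c * (4 / N + 8 / x) ≤ 4 + 4 * x := by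
    calc c * (4 / N + 8 / x) ≤ N * (4 / N + 8 / x) := by gcongr
      _ = 4 + 8 * N / x := by field_simp
      _ ≤ 4 + 4 * x := by
        gcongr
        rw [div_le_iff₀ hx0]
        nlinarith
  linarith

theorem sum_card_lateFree_le (hn : 2 ≤ n) {k : ℕ} (hk : n * Real.log n ≤ k) :
    ∑ σ : EdgeOrder n, ((lateFree (2 * k) σ).card : ℝ) ≤
      (1296 * (n * Real.log n) + 4 + 4 * n) * Fintype.card (EdgeOrder n) := by
  have hn2 : (2 : ℝ) ≤ n := by exact_mod_cast hn
  have hlog : 0 < Real.log n := Real.log_pos (by linarith)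
  have hkpos : (0 : ℝ) < k := lt_of_lt_of_le (by positivity) hk
  have hk1 : 1 ≤ k := by exact_mod_cast hkpos
  set N := Fintype.card (Edge n) with hN
  set E : ℝ := ((Fintype.card (EdgeOrder n) : ℕ) : ℝ) with hE
  have hEpos : 0 < E := card_edgeOrder_pos n
  set I := (Finset.univ : Finset (Fin N)).filter (2 * k ≤ ·.val) with hI
  have hN2 : 2 * (N : ℝ) + n = (n : ℝ) ^ 2 := by
    rw [sq]; exact_mod_cast two_mul_card_edge n
  have h1 : ∑ σ : EdgeOrder n, ((lateFree (2 * k) σ).card : ℝ) =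
      ∑ i ∈ I, ∑ σ : EdgeOrder n,
        (if σ i ∈ freeEdges (firstEdges σ (i.val / 2)) then (1 : ℝ) else 0) := by
    classical
    rw [Finset.sum_comm]
    refine Finset.sum_congr rfl fun σ _ => ?_
    rw [Finset.sum_boole]
    rfl
  rw [h1]
  refine (Finset.sum_le_sum fun i hi => sum_mem_freeEdges_le hn i ?_).trans ?_
  · have := (Finset.mem_filter.1 hi).2
    omega
  rw [← Finset.sum_mul, Finset.sum_add_distrib, ← Finset.mul_sum, Finset.sum_const, nsmul_eq_mul]
  refine mul_le_mul_of_nonneg_right ?_ hEpos.le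
  have h2 : ∑ i ∈ I, ((i.val : ℝ) ^ 2)⁻¹ ≤ (n * Real.log n)⁻¹ := by
    refine (sum_inv_sq_le (by omega)).trans ?_
    gcongr
    -- Starting at `2 k` absorbs the loss of one in the tail bound, as `2 k - 1 ≥ k`.
    exact hk.trans (by exact_mod_cast (by omega : k ≤ 2 * k - 1))
  have h3 : (I.card : ℝ) ≤ N := by
    have := Finset.card_le_univ I
    rw [Fintype.card_fin] at this
    exact_mod_cast this
  have hsum := late_sum_le hn2 hlog hN2 h2 (Finset.sum_nonneg fun i _ => by positivity) h3
  linarith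

theorem expectation_peakSpace_le (hn : 2 ≤ n) (m : ℕ) :
    expectation (fun σ : EdgeOrder n => (dfsAlgorithm.peakSpace (firstEdges σ m) : ℝ)) ≤
      3000 * n * Real.log n := by
  have hn2 : (2 : ℝ) ≤ n := by exact_mod_cast hn
  have hlog2 : 1 / 2 ≤ Real.log n := by
    have h1 := Real.log_two_gt_d9
    have h2 := Real.log_le_log (by norm_num) hn2
    linarith
  set k := ⌈n * Real.log n⌉₊ with hkdef
  have hk : n * Real.log n ≤ k := Nat.le_ceil _
  have hk' : (k : ℝ) < n * Real.log n + 1 := Nat.ceil_lt_add_one (by positivity)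
  have hkpos : 0 < 2 * k := by
    have : 0 < k := Nat.ceil_pos.2 (by positivity)
    omega
  have hEpos := card_edgeOrder_pos n
  rw [expectation, div_le_iff₀ hEpos]
  have h1 : ∀ σ : EdgeOrder n, (dfsAlgorithm.peakSpace (firstEdges σ m) : ℝ) ≤
      (n + 4 * k) + 2 * ((lateFree (2 * k) σ).card : ℝ) := by
    intro σ
    have := peakSpace_le hkpos σ m
    have h' : (dfsAlgorithm.peakSpace (firstEdges σ m) : ℝ) ≤
        n + 2 * ((2 * k : ℕ) + ((lateFree (2 * k) σ).card : ℝ)) := by exact_mod_cast this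
    push_cast at h'
    linarith
  refine (Finset.sum_le_sum fun σ _ => h1 σ).trans ?_
  rw [Finset.sum_add_distrib, Finset.sum_const, Finset.card_univ, nsmul_eq_mul, ← Finset.mul_sum]
  have h2 := sum_card_lateFree_le hn hk
  set E : ℝ := ((Fintype.card (EdgeOrder n) : ℕ) : ℝ) with hE
  -- Since `log n ≥ 1 / 2` and `n ≥ 2`, the lower-order terms are at most multiples of `n log n`;
  -- the total stays below 3000.
  have h3 : (n : ℝ) + 4 * k + 2 * (1296 * (n * Real.log n) + 4 + 4 * n) ≤
      3000 * n * Real.log n := by nlinarith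
  have h4 := mul_le_mul_of_nonneg_right h3 hEpos.le
  linarith

end Space

end SemiStream

theorem mainTheorem7 :
    ∃ A : SemiStream.Algorithm,
      (∀ (n : ℕ) (L : List (SemiStream.Edge n)), L.Nodup →
        SemiStream.IsDFSTree (SemiStream.augGraph L) (Fin.last n) (A.run L).par) ∧
      (∀ (n : ℕ) (L : List (SemiStream.Edge n)) (e : SemiStream.Edge n), (L ++ [e]).Nodup →
        (A.run L).TouchesStick e → e ∉ (A.run (L ++ [e])).stored) ∧
      ∃ C : ℝ, 0 < C ∧ ∀ n : ℕ, 2 ≤ n → ∀ m : ℕ, m ≤ n.choose 2 →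
        SemiStream.expectation
            (fun σ : SemiStream.EdgeOrder n =>
              (A.peakSpace (SemiStream.firstEdges σ m) : ℝ)) ≤
          C * n * Real.log n := by
  refine ⟨SemiStream.dfsAlgorithm, fun n L _ => (SemiStream.invariant_run L).isDFSTree,
    fun n L e _ h => SemiStream.notMem_stored_run (SemiStream.touchesStick_run_append h [e]),
    3000, by norm_num, fun n hn m _ => SemiStream.expectation_peakSpace_le hn m⟩
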